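/- Setting. There are $n$ agents and $m$ items. Each agent $i$ has an XOS valuation $v_i(S)=\max_{\ell}\sum_{j\in S} v^{\ell}_{i,j}$, given by finitely many (at least one) additive clauses with values $v^\ell_{i,j}\ge 0$. Agents place bids $b_{i,j}\ge 0$. Each item is assigned to an agent with the highest bid on it, ties being broken by an arbitrary but fixed rule, at the price $\max_{i'\ne i} b_{i',j}$ for the winner $i$. If $S_1,\dots,S_n$ are the sets of items won at $b$, then $u_i(b)=v_i(S_i)-\sum_{j\in S_i}\max_{i'\neq i}b_{i',j}$ is the utility of agent $i$ and $SW(b)=\sum_i v_i(S_i)$ is the social welfare; $OPT$ is the maximum of $\sum_i v_i(S_i)$ over all partitions $S_1,\dots,S_n$ of the items. When agent $i$ is activated in the Potential Procedure, its bid stays unchanged if it already is a best response (maximizes $u_i$ against the current bids of the others). Otherwise the agent picks an arbitrary demand set $D$, that is, a maximizer of $v_i(S)-\sum_{j\in S}\max_{i'\neq i}b_{i',j}$, and an arbitrary clause $\ell$ with $\sum_{j\in D}v^\ell_{i,j}=v_i(D)$, and changes its bids to $v^\ell_{i,j}$ for $j\in D$ and $0$ for $j\notin D$. Theorem 5.3.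 There is a function $f:\mathbb N\to\mathbb N$ with $f(k)=\Omega(2^k)$ such that for every $\varepsilon>0$, every $n\ge 2$, every $k\ge 0$ and every tie-breaking rule there are an instance with $n$ agents with XOS valuations and $(n-1)(k+1)$ items, an initial bid vector $b^0$ satisfying strong no-overbidding ($\sum_{j\in S}b^0_{i,j}\le v_i(S)$ for all agents $i$ and all sets $S$ of items), a sequence of activations, and a number $T$ of steps, such that every agent is activated at least $f(k)$ times during the first $T$ steps, and every sequence $b^0,b^1,b^2,\dots$ that arises from these activations through updates of the Potential Procedure (for every choice of demand sets and supporting clauses) satisfies $$SW(b^t)\le\frac{1+\varepsilon}{n-1}\,OPT\qquad\text{for all } 0\le t\le T,$$ and in each of the first $T$ steps the activated agent is not yet playing a best response, so that each of these activations is a strictly improving update. -/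

import Mathlib

open scoped NNReal

/-- A bid profile of `n` agents on `m` items: `b i j` is the bid of agent `i` on item `j`. -/
abbrev Bids (n m : ℕ) : Type := Fin n → Fin m → ℝ≥0

/-- An instance with `n` agents and `m` items in which every agent has an XOS (fractionally
subadditive) valuation, given by a finite nonempty list of additive clauses:
`weight i ℓ j` is the value that the `ℓ`-th clause of agent `i` gives to item `j`. -/
structure XOSInstance (n m : ℕ) where
  clauses : Fin n → ℕ
  weight : (i : Fin n) → Fin (clauses i + 1) → Fin m → ℝ≥0

/-- The XOS valuation of agent `i`: the maximum of the additive clauses. -/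
noncomputable def XOSInstance.value {n m : ℕ} (I : XOSInstance n m) (i : Fin n)
    (S : Finset (Fin m)) : ℝ≥0 :=
  Finset.univ.sup fun ℓ => ∑ j ∈ S, I.weight i ℓ j

/-- The maximum of social welfare over all allocations `o` of the items to the agents. -/
noncomputable def XOSInstance.opt {n m : ℕ} (I : XOSInstance n m) : ℝ≥0 :=
  Finset.univ.sup fun o : Fin m → Fin n =>
    ∑ i, I.value i (Finset.univ.filter fun j => o j = i)

/-- The allocation rule of simultaneous item auctions with a fixed, otherwise arbitrary
tie-breaking: each item goes to an agent with the highest bid on it. -/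
structure AllocationRule (n m : ℕ) where
  winner : Bids n m → Fin m → Fin n
  highest : ∀ (b : Bids n m) (j : Fin m) (i : Fin n), b i j ≤ b (winner b j) j

/-- The set of items won by agent `i`. -/
def AllocationRule.won {n m : ℕ} (R : AllocationRule n m) (b : Bids n m) (i : Fin n) :
    Finset (Fin m) :=
  Finset.univ.filter fun j => R.winner b j = i

/-- The second price that agent `i` faces on item `j`: the highest bid of the other agents. -/
noncomputable def price {n m : ℕ} (b : Bids n m) (i : Fin n) (j : Fin m) : ℝ≥0 :=
  (Finset.univ.erase i).sup fun i' => b i' j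

/-- Social welfare of the allocation at the bid profile `b`. -/
noncomputable def socialWelfare {n m : ℕ} (R : AllocationRule n m) (I : XOSInstance n m)
    (b : Bids n m) : ℝ≥0 :=
  ∑ i, I.value i (R.won b i)

/-- The utility that agent `i` would have from buying the set `S` at the current prices. -/
noncomputable def surplus {n m : ℕ} (I : XOSInstance n m) (b : Bids n m) (i : Fin n)
    (S : Finset (Fin m)) : ℝ :=
  (I.value i S : ℝ) - ∑ j ∈ S, (price b i j : ℝ)

/-- Quasi-linear utility of agent `i` at the bid profile `b`. -/
noncomputable def utility {n m : ℕ} (R : AllocationRule n m) (I : XOSInstance n m)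
    (b : Bids n m) (i : Fin n) : ℝ :=
  surplus I b i (R.won b i)

/-- In the profile `b`, the bid of agent `i` is a best response to the other bids. -/
def IsBestResponse {n m : ℕ} (R : AllocationRule n m) (I : XOSInstance n m)
    (b : Bids n m) (i : Fin n) : Prop :=
  ∀ c : Fin m → ℝ≥0, utility R I (Function.update b i c) i ≤ utility R I b i

/-- `D` is a demand set of agent `i` at the prices given by the other agents' bids. -/
def IsDemandSet {n m : ℕ} (I : XOSInstance n m) (b : Bids n m) (i : Fin n)
    (D : Finset (Fin m)) : Prop :=
  ∀ S : Finset (Fin m), surplus I b i S ≤ surplus I b i D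

/-- One step of the Potential Procedure, in which agent `i` is activated at the profile `b` and
`b'` is the next profile. If the agent already plays a best response, nothing changes. Otherwise
the agent picks some demand set `D` and some clause supporting the valuation on `D`, and bids
this clause on `D` and zero on all other items. -/
def PotentialStep {n m : ℕ} (R : AllocationRule n m) (I : XOSInstance n m)
    (i : Fin n) (b b' : Bids n m) : Prop :=
  (IsBestResponse R I b i ∧ b' = b) ∨
  (¬ IsBestResponse R I b i ∧
    ∃ (D : Finset (Fin m)) (ℓ : Fin (I.clauses i + 1)),
      IsDemandSet I b i D ∧ ∑ j ∈ D, I.weight i ℓ j = I.value i D ∧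
      b' = Function.update b i fun j => if j ∈ D then I.weight i ℓ j else 0)

/-- `b 0, b 1, b 2, …` is a run of the Potential Procedure from `b₀`, where agent `act t` is
activated in the step from `b t` to `b (t + 1)`. -/
def IsPotentialRun {n m : ℕ} (R : AllocationRule n m) (I : XOSInstance n m)
    (b₀ : Bids n m) (act : ℕ → Fin n) (b : ℕ → Bids n m) : Prop :=
  b 0 = b₀ ∧ ∀ t, PotentialStep R I (act t) (b t) (b (t + 1))

/-- Strong no-overbidding: no agent bids more on a set of items in total than its value. -/
def StrongNoOverbidding {n m : ℕ} (I : XOSInstance n m) (b : Bids n m) : Prop :=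
  ∀ (i : Fin n) (S : Finset (Fin m)), ∑ j ∈ S, b i j ≤ I.value i S

/-- How often agent `i` is activated in the first `T` steps. -/
def activations {n : ℕ} (act : ℕ → Fin n) (T : ℕ) (i : Fin n) : ℕ :=
  ((Finset.range T).filter fun t => act t = i).card

/-! The instance has one fighting agent (the last one) and `N = n - 1` owners, each with a group of
`k + 1` items. The owner of a group values its big item at a huge `B`, so `OPT ≥ N * B`. But the
fighting agent bids at least one on all big items while the owners bid zero there, so no owner wins
its own big item. Only the fighting agent can collect about `B`, and only once; the rest of the
welfare is independent of `B`. An owner is activated only while the fighting agent bids at least `B`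
on its big item, so its clause for that item is worthless at that moment.

It remains to make activations strictly improving for exponentially long. In a `Duel` two players
reply to each other on `K` items, each vector being the unique best reply to its predecessor. The
duel follows a walk in a cube of dimension linear in `K`: a coordinate records who holds an item,
and the bidder at time `t` bids 0 on items it does not hold, 2 on items it keeps, and 1 on items it
is about to lose. With a compensation paid from an uncontested item, a vector ties with the best
reply only if no coordinate separates the two swept subcubes. A reflected walk of exponential length
has such separating coordinates for all relevant pairs of times (`walk_separation`), so only the
vectors at `s + 1` and `s - 1` can tie as replies at time `s`, and a small bonus for later times
prefers `s + 1` (`longDuel`).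

The fighting agent duels with the owners one after another. Position bonuses `(N - j) * gap` fix the
order of the groups; at the end of its duel an owner takes the key item, which makes the fighting
agent move on. All nonzero bids strictly beat the prices, so ties, demand sets and supporting
clauses leave no freedom (`eq_update_of_potentialStep`), and induction on the phases
(`phase_of_run`) determines every run. -/

/-! ### A reflected walk in the cube. -/

/-- The length of the walk `walk κ`. -/
def walkLength (κ : ℕ) : ℕ := 4 * 2 ^ κ - 2

/-- A self-avoiding walk in the cube with `κ + 2` coordinates, built by reflection: coordinate `e`
of the `t`-th position. -/
def walk : ℕ → ℕ → ℕ → Bool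
  | 0, t, e => if e = 0 then decide (t ≤ 1) else decide (1 ≤ t)
  | κ + 1, t, e =>
    if e = κ + 2 then decide (walkLength κ < t)
    else walk κ (min (min (walkLength κ) t) (2 * walkLength κ + 2 - t)) e

theorem walkLength_zero : walkLength 0 = 2 := rfl

/-- The walk there and back, one step for the new coordinate, and one idle step that gives the
reversed steps the right parity. -/
theorem walkLength_succ (κ : ℕ) : walkLength (κ + 1) = 2 * walkLength κ + 2 := by
  have : 1 ≤ 2 ^ κ := Nat.one_le_two_pow
  simp only [walkLength, pow_succ]
  omega

theorem two_le_walkLength (κ : ℕ) : 2 ≤ walkLength κ := by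
  have : 1 ≤ 2 ^ κ := Nat.one_le_two_pow
  simp only [walkLength]
  omega

theorem even_walkLength (κ : ℕ) : walkLength κ % 2 = 0 := by
  simp only [walkLength]
  omega

theorem walk_succ_last (κ t : ℕ) : walk (κ + 1) t (κ + 2) = decide (walkLength κ < t) := by
  simp [walk]

theorem walk_succ_of_ne {κ e : ℕ} (t : ℕ) (he : e ≠ κ + 2) :
    walk (κ + 1) t e = walk κ (min (min (walkLength κ) t) (2 * walkLength κ + 2 - t)) e := by
  simp [walk, he]

/-- At even times coordinates of the walk are only switched on, at odd times only switched off. -/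
theorem walk_mono (κ : ℕ) : ∀ t < walkLength κ, ∀ e < κ + 2,
    walk κ t e ≠ decide (t % 2 = 1) → walk κ (t + 1) e = walk κ t e := by
  induction κ with
  | zero =>
    intro t ht e he
    rw [walkLength_zero] at ht
    interval_cases t <;> interval_cases e <;> simp [walk]
  | succ κ ih =>
    intro t ht e he h
    have hL := even_walkLength κ
    rw [walkLength_succ] at ht
    by_cases hk : e = κ + 2
    · subst hk
      rw [walk_succ_last] at h ⊢
      rw [walk_succ_last]
      by_cases h1 : walkLength κ < t
      · simp [h1, Nat.lt_succ_of_lt h1]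
      · by_cases h2 : walkLength κ = t
        · subst h2; simp [hL] at h
        · simp [h1, show ¬ walkLength κ < t + 1 by omega]
    · rw [walk_succ_of_ne _ hk] at h ⊢
      rw [walk_succ_of_ne _ hk]
      rcases lt_or_ge t (walkLength κ) with h1 | h1
      · rw [show min (min (walkLength κ) t) (2 * walkLength κ + 2 - t) = t by omega] at h ⊢
        rw [show min (min (walkLength κ) (t + 1)) (2 * walkLength κ + 2 - (t + 1)) = t + 1 by omega]
        exact ih t h1 e (by omega) h
      · rcases lt_or_ge t (walkLength κ + 2) with h2 | h2
        · congr 1; omega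
        -- On the way back, step `d` is run in reverse at time `t`. Its direction flips, and so does
        -- the parity of the time.
        · obtain ⟨d, hd⟩ : ∃ d, t + d = 2 * walkLength κ + 1 := ⟨_, Nat.add_sub_of_le (by omega)⟩
          rw [show min (min (walkLength κ) t) (2 * walkLength κ + 2 - t) = d + 1 by omega] at h ⊢
          rw [show min (min (walkLength κ) (t + 1)) (2 * walkLength κ + 2 - (t + 1)) = d by omega]
          by_contra hne
          have h3 := mt (ih d (by omega) e (by omega)) (Ne.symm hne)
          rw [not_not] at h3
          have h4 : walk κ (d + 1) e = walk κ d e := by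
            rw [h3]
            have h5 : (d % 2 = 1) ↔ ¬ (t % 2 = 1) := by omega
            simp only [h5]
            generalize walk κ (d + 1) e = x at h
            revert h
            by_cases h6 : t % 2 = 1 <;> cases x <;> simp [h6]
          exact hne h4.symm

/-- No coordinate of the walk changes twice in a row. -/
theorem walk_stable (κ : ℕ) : ∀ t, t + 2 ≤ walkLength κ → ∀ e < κ + 2,
    walk κ t e ≠ walk κ (t + 1) e → walk κ (t + 1) e = walk κ (t + 2) e := by
  induction κ with
  | zero =>
    intro t ht e he
    rw [walkLength_zero] at ht
    obtain rfl : t = 0 := by omega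
    interval_cases e <;> simp [walk]
  | succ κ ih =>
    intro t ht e he h
    rw [walkLength_succ] at ht
    by_cases hk : e = κ + 2
    · subst hk
      simp only [walk_succ_last, ne_eq, decide_eq_decide] at h ⊢
      omega
    · simp only [walk_succ_of_ne _ hk] at h ⊢
      rcases le_or_gt (t + 2) (walkLength κ) with h1 | h1
      · rw [show min (min (walkLength κ) (t + 1)) (2 * walkLength κ + 2 - (t + 1)) = t + 1 by omega]
          at h ⊢
        rw [show min (min (walkLength κ) t) (2 * walkLength κ + 2 - t) = t by omega] at h
        rw [show min (min (walkLength κ) (t + 2)) (2 * walkLength κ + 2 - (t + 2)) = t + 2 by omega]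
        exact ih t h1 e (by omega) h
      · rcases lt_or_ge t (walkLength κ + 2) with h2 | h2
        · by_cases h3 : t + 1 = walkLength κ ∨ t = walkLength κ
          · congr 1; omega
          · refine absurd ?_ h
            congr 1; omega
        · obtain ⟨d, hd⟩ : ∃ d, t + d = 2 * walkLength κ := ⟨_, Nat.add_sub_of_le (by omega)⟩
          rw [show min (min (walkLength κ) (t + 1)) (2 * walkLength κ + 2 - (t + 1)) = d + 1 by omega]
            at h ⊢
          rw [show min (min (walkLength κ) t) (2 * walkLength κ + 2 - t) = d + 2 by omega] at h
          rw [show min (min (walkLength κ) (t + 2)) (2 * walkLength κ + 2 - (t + 2)) = d by omega]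
          by_contra h4
          exact h (ih d (by omega) e (by omega) (Ne.symm h4)).symm

/-- The subcubes swept in the steps `i` and `j` of the walk are separated by a coordinate. -/
def WalkSep (κ i j : ℕ) : Prop :=
  ∃ e < κ + 2, walk κ i e = walk κ (i + 1) e ∧ walk κ j e = walk κ (j + 1) e ∧
    walk κ i e ≠ walk κ j e

/-- The subcube swept in step `j` of the walk avoids the position at time `i`. -/
def WalkAvoids (κ i j : ℕ) : Prop :=
  ∃ e < κ + 2, walk κ j e = walk κ (j + 1) e ∧ walk κ i e ≠ walk κ j e

theorem walk_succ_left {κ t e : ℕ} (ht : t ≤ walkLength κ) (he : e < κ + 2) :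
    walk (κ + 1) t e = walk κ t e := by
  rw [walk_succ_of_ne _ he.ne]
  congr 1; omega

theorem walk_succ_right {κ t d e : ℕ} (ht : t + d = 2 * walkLength κ + 2) (hd : d ≤ walkLength κ)
    (he : e < κ + 2) : walk (κ + 1) t e = walk κ d e := by
  rw [walk_succ_of_ne _ he.ne]
  congr 1; omega

theorem walk_succ_mid {κ e : ℕ} (he : e < κ + 2) :
    walk (κ + 1) (walkLength κ + 1) e = walk κ (walkLength κ) e := by
  rw [walk_succ_of_ne _ he.ne]
  congr 1; omega

/-- Steps strictly on different sides of the turn are separated by the new coordinate, steps on the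
same side by induction. At the turn itself the old coordinates rest at the end of the shorter walk,
which is why avoidance of both endpoints is carried through the induction. -/
theorem walk_separation (κ : ℕ) :
    (∀ i j, i + 3 ≤ j → j < walkLength κ → i % 2 ≠ j % 2 → WalkSep κ i j) ∧
    (∀ j, 1 ≤ j → j < walkLength κ → WalkAvoids κ 0 j) ∧
    (∀ j, j + 2 ≤ walkLength κ → WalkAvoids κ (walkLength κ) j) := by
  induction κ with
  | zero =>
    rw [walkLength_zero]
    refine ⟨by omega, fun j h1 h2 => ?_, fun j h1 => ?_⟩
    · obtain rfl : j = 1 := by omega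
      exact ⟨1, by simp [walk]⟩
    · obtain rfl : j = 0 := by omega
      exact ⟨0, by simp [walk]⟩
  | succ κ ih =>
    obtain ⟨ihs, ih0, ihL⟩ := ih
    have hL := even_walkLength κ
    have hL2 := two_le_walkLength κ
    have hends : ∃ e < κ + 2, walk κ 0 e ≠ walk κ (walkLength κ) e := by
      obtain ⟨e, he, h1, h2⟩ := ih0 (walkLength κ - 1) (by omega) (by omega)
      rw [show walkLength κ - 1 + 1 = walkLength κ by omega] at h1
      exact ⟨e, he, h1 ▸ h2⟩
    rw [walkLength_succ]
    refine ⟨fun i j hij hj hpar => ?_, fun j h1 h2 => ?_, fun j h1 => ?_⟩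
    · rcases lt_or_ge j (walkLength κ) with hjL | hjL
      · obtain ⟨e, he, h⟩ := ihs i j hij hjL hpar
        refine ⟨e, by omega, ?_⟩
        rwa [walk_succ_left (by omega) he, walk_succ_left (by omega) he,
          walk_succ_left (by omega) he, walk_succ_left (by omega) he]
      rcases lt_or_ge i (walkLength κ) with hiL | hiL
      · rcases hjL.eq_or_lt with rfl | hjL
        · obtain ⟨e, he, h1, h2⟩ := ihL i (by omega)
          refine ⟨e, by omega, ?_⟩
          rw [walk_succ_left (by omega) he, walk_succ_left (by omega) he,
            walk_succ_left le_rfl he, walk_succ_mid he]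
          exact ⟨h1, rfl, h2.symm⟩
        · refine ⟨κ + 2, by omega, ?_⟩
          simp only [walk_succ_last, ne_eq, decide_eq_decide]
          omega
      obtain ⟨d, hd⟩ : ∃ d, j + d = 2 * walkLength κ + 1 := ⟨_, Nat.add_sub_of_le (by omega)⟩
      rcases lt_or_ge i (walkLength κ + 2) with hi2 | hi2
      · obtain ⟨e, he, h1, h2⟩ := ihL d (by omega)
        have hi : walk (κ + 1) i e = walk κ (walkLength κ) e ∧
            walk (κ + 1) (i + 1) e = walk κ (walkLength κ) e := by
          rcases hiL.eq_or_lt with rfl | h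
          · exact ⟨walk_succ_left le_rfl he, walk_succ_mid he⟩
          · obtain rfl : i = walkLength κ + 1 := by omega
            exact ⟨walk_succ_mid he, walk_succ_right (by omega) le_rfl he⟩
        refine ⟨e, by omega, ?_⟩
        rw [hi.1, hi.2, walk_succ_right (d := d + 1) (by omega) (by omega) he,
          walk_succ_right (d := d) (by omega) (by omega) he]
        exact ⟨rfl, h1.symm, h1 ▸ h2⟩
      · obtain ⟨c, hc⟩ : ∃ c, i + c = 2 * walkLength κ + 1 := ⟨_, Nat.add_sub_of_le (by omega)⟩
        obtain ⟨e, he, h1, h2, h3⟩ := ihs d c (by omega) (by omega) (by omega)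
        refine ⟨e, by omega, ?_⟩
        rw [walk_succ_right (t := j) (d := d + 1) (by omega) (by omega) he,
          walk_succ_right (t := j + 1) (d := d) (by omega) (by omega) he,
          walk_succ_right (t := i) (d := c + 1) (by omega) (by omega) he,
          walk_succ_right (t := i + 1) (d := c) (by omega) (by omega) he]
        exact ⟨h2.symm, h1.symm, by rw [← h1, ← h2]; exact h3.symm⟩
    · rcases lt_trichotomy j (walkLength κ) with hj | rfl | hj
      · obtain ⟨e, he, h⟩ := ih0 j h1 hj
        refine ⟨e, by omega, ?_⟩
        rwa [walk_succ_left (by omega) he, walk_succ_left (by omega) he,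
          walk_succ_left (by omega) he]
      · obtain ⟨e, he, h⟩ := hends
        refine ⟨e, by omega, ?_⟩
        rw [walk_succ_left le_rfl he, walk_succ_left (t := 0) (by omega) he, walk_succ_mid he]
        exact ⟨rfl, h⟩
      · refine ⟨κ + 2, by omega, ?_⟩
        simp only [walk_succ_last, ne_eq, decide_eq_decide]
        omega
    · rcases lt_or_ge j (walkLength κ) with hj | hj
      · refine ⟨κ + 2, by omega, ?_⟩
        simp only [walk_succ_last, ne_eq, decide_eq_decide]
        omega
      obtain ⟨e, he, h⟩ := hends
      rcases lt_or_ge j (walkLength κ + 2) with hj2 | hj2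
      · have hi : walk (κ + 1) j e = walk κ (walkLength κ) e ∧
            walk (κ + 1) (j + 1) e = walk κ (walkLength κ) e := by
          rcases hj.eq_or_lt with rfl | h
          · exact ⟨walk_succ_left le_rfl he, walk_succ_mid he⟩
          · obtain rfl : j = walkLength κ + 1 := by omega
            exact ⟨walk_succ_mid he, walk_succ_right (by omega) le_rfl he⟩
        refine ⟨e, by omega, ?_⟩
        rw [hi.1, hi.2, walk_succ_right (d := 0) (by omega) (by omega) he]
        exact ⟨rfl, h⟩
      · obtain ⟨d, hd⟩ : ∃ d, j + d = 2 * walkLength κ + 1 := ⟨_, Nat.add_sub_of_le (by omega)⟩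
        obtain ⟨e, he, h1, h2⟩ := ih0 d (by omega) (by omega)
        refine ⟨e, by omega, ?_⟩
        rw [walk_succ_right (t := 2 * walkLength κ + 2) (d := 0) (by omega) (by omega) he,
          walk_succ_right (t := j) (d := d + 1) (by omega) (by omega) he,
          walk_succ_right (t := j + 1) (d := d) (by omega) (by omega) he]
        exact ⟨h1.symm, h1 ▸ h2⟩

/-! ### Holders of the contested items. -/

/-- A walk around a hexagon in the three-dimensional cube. -/
def hexagon (t e : ℕ) : Bool :=
  if e = 0 then decide (t % 6 = 1 ∨ t % 6 = 2 ∨ t % 6 = 3)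
  else if e = 1 then decide (t % 6 = 5 ∨ t % 6 = 0 ∨ t % 6 = 1)
  else decide (t % 6 = 3 ∨ t % 6 = 4 ∨ t % 6 = 5)

theorem hexagon_mono (t e : ℕ) (h : hexagon t e ≠ decide (t % 2 = 1)) :
    hexagon (t + 1) e = hexagon t e := by
  unfold hexagon at *
  split_ifs at * <;> simp only [ne_eq, decide_eq_decide] at * <;> omega

theorem hexagon_stable (t e : ℕ) (h : hexagon t e ≠ hexagon (t + 1) e) :
    hexagon (t + 1) e = hexagon (t + 2) e := by
  unfold hexagon at *
  split_ifs at * <;> simp only [ne_eq, decide_eq_decide] at * <;> omega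

/-- The reflected walk idles after its turns; the hexagon ensures that some item changes hands in
every step. -/
theorem hexagon_moves (t : ℕ) : ∃ e < 3, hexagon t e ≠ hexagon (t + 1) e := by
  by_cases h0 : t % 3 = 0
  · refine ⟨0, by omega, ?_⟩
    simp only [hexagon, if_true, ne_eq, decide_eq_decide]; omega
  by_cases h1 : t % 3 = 1
  · refine ⟨1, by omega, ?_⟩
    simp only [hexagon, if_true, one_ne_zero, if_false, ne_eq, decide_eq_decide]; omega
  · refine ⟨2, by omega, ?_⟩
    simp only [hexagon, OfNat.ofNat_ne_zero, OfNat.ofNat_ne_one, if_false, ne_eq, decide_eq_decide]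
    omega

/-- Which of the two players holds item `e` at time `t` of the duel. -/
def holder (κ t e : ℕ) : Bool :=
  if e < κ + 2 then walk κ (min t (walkLength κ)) e else hexagon t (e - (κ + 2))

theorem holder_mono {κ t e : ℕ} (h : holder κ t e ≠ decide (t % 2 = 1)) :
    holder κ (t + 1) e = holder κ t e := by
  unfold holder at *
  split_ifs at * with he
  · rcases lt_or_ge t (walkLength κ) with ht | ht
    · rw [min_eq_left (by omega)] at *
      rw [min_eq_left (by omega)]
      exact walk_mono κ t ht e he h
    · rw [min_eq_right ht, min_eq_right (by omega)]
  · exact hexagon_mono _ _ h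

theorem holder_stable {κ t e : ℕ} (h : holder κ t e ≠ holder κ (t + 1) e) :
    holder κ (t + 1) e = holder κ (t + 2) e := by
  unfold holder at *
  split_ifs at * with he
  · rcases le_or_gt (t + 2) (walkLength κ) with ht | ht
    · rw [min_eq_left (by omega), min_eq_left (by omega)] at *
      exact walk_stable κ t ht e he h
    · rw [min_eq_right (by omega), min_eq_right (by omega)]
  · exact hexagon_stable _ _ h

theorem holder_moves (κ t : ℕ) : ∃ e < κ + 5, holder κ t e ≠ holder κ (t + 1) e := by
  obtain ⟨e, he, h⟩ := hexagon_moves t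
  refine ⟨κ + 2 + e, by omega, ?_⟩
  simpa [holder] using h

/-- `level` looks one step ahead, so `j = walkLength κ` matters too. There the frozen walk is
stationary, and endpoint avoidance applies. -/
theorem holder_separation {κ i j : ℕ} (hij : i + 3 ≤ j) (hj : j ≤ walkLength κ)
    (hpar : i % 2 ≠ j % 2) :
    ∃ e < κ + 5, holder κ i e = holder κ (i + 1) e ∧ holder κ j e = holder κ (j + 1) e ∧
      holder κ i e ≠ holder κ j e := by
  rcases hj.lt_or_eq with hj | rfl
  · obtain ⟨e, he, h⟩ := (walk_separation κ).1 i j hij hj hpar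
    refine ⟨e, by omega, ?_⟩
    simp only [holder, if_pos he]
    rwa [min_eq_left (by omega), min_eq_left (by omega), min_eq_left (by omega),
      min_eq_left (by omega)]
  · obtain ⟨e, he, h1, h2⟩ := (walk_separation κ).2.2 i (by omega)
    refine ⟨e, by omega, ?_⟩
    simp only [holder, if_pos he]
    rw [min_eq_left (by omega), min_eq_left (by omega), min_eq_left (by omega),
      min_eq_right (by omega)]
    exact ⟨h1, rfl, h2.symm⟩

/-! ### Exponentially long duels. -/

/-- A sequence of bid vectors on `K` items at the times `0, …, L`, made alternately by two players
at the even and at the odd times, such that at every time the next vector is the strictly best reply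
to the current one among all vectors of the replying player. Here `reserve t` is the value that the
bidder of the vector `t` gets in addition from items which are not contested. -/
structure Duel (K L : ℕ) where
  bid : ℕ → Fin K → ℕ
  reserve : ℕ → ℕ
  -- Truncated subtraction expresses that only items worth their price are bought.
  best : ∀ s t, s + 1 ≤ L → t ≤ L → t % 2 ≠ s % 2 → t ≠ s + 1 →
    reserve t + ∑ e, (bid t e - bid s e) < reserve (s + 1) + ∑ e, (bid (s + 1) e - bid s e)
  outbid : ∀ s, s + 1 ≤ L → ∀ e, bid (s + 1) e = 0 ∨ bid s e < bid (s + 1) e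
  progress : ∀ s, s + 1 ≤ L → ∃ e, (1 ≤ s → bid (s - 1) e = 0) ∧ 0 < bid s e ∧
    bid s e < bid (s + 1) e

/-- The bid on item `e` at time `t`, in multiples of a unit. -/
def level (κ t e : ℕ) : ℕ :=
  if holder κ t e ≠ decide (t % 2 = 1) then 0
  else if holder κ (t + 1) e = decide (t % 2 = 1) then 2 else 1

/-- The compensation for a bid on item `e` at time `t` that is not full, in multiples of a unit. -/
def compensation (κ t e : ℕ) : ℕ := if level κ t e = 2 then 0 else 1

theorem decide_odd_succ (t : ℕ) : decide ((t + 1) % 2 = 1) = !decide (t % 2 = 1) := by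
  rw [← decide_not, decide_eq_decide]; omega

theorem decide_odd_of_ne {s t : ℕ} (h : t % 2 ≠ s % 2) :
    decide (t % 2 = 1) = !decide (s % 2 = 1) := by
  rw [← decide_not, decide_eq_decide]; omega

/-- With the next two lemmas: around a change of hands the bids are 0, 1, 2. This yields
`Duel.progress`. -/
theorem level_eq_one {κ s e : ℕ} (h : holder κ s e ≠ holder κ (s + 1) e) : level κ s e = 1 := by
  have h1 : holder κ s e = decide (s % 2 = 1) := by
    by_contra h2
    exact h (holder_mono h2).symm
  have h3 : holder κ (s + 1) e ≠ decide (s % 2 = 1) := fun h4 => h (h1.trans h4.symm)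
  simp [level, h1, h3]

theorem level_succ_eq_two {κ s e : ℕ} (h : holder κ s e ≠ holder κ (s + 1) e) :
    level κ (s + 1) e = 2 := by
  have h1 : holder κ s e = decide (s % 2 = 1) := by
    by_contra h2
    exact h (holder_mono h2).symm
  have h3 : holder κ (s + 1) e = decide ((s + 1) % 2 = 1) := by
    rw [decide_odd_succ, ← h1]
    revert h
    cases holder κ s e <;> cases holder κ (s + 1) e <;> simp
  have h4 := holder_stable h
  simp [level, ← h3, ← h4]

theorem level_pred_eq_zero {κ s e : ℕ} (h : holder κ (s + 1) e ≠ holder κ (s + 2) e) :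
    level κ s e = 0 := by
  have h1 : holder κ s e = holder κ (s + 1) e := by
    by_contra h2
    exact h (holder_stable h2)
  have h3 : holder κ (s + 1) e = decide ((s + 1) % 2 = 1) := by
    by_contra h2
    exact h (holder_mono h2).symm
  rw [decide_odd_succ] at h3
  simp [level, h1, h3]

theorem level_outbid (κ s e : ℕ) : level κ (s + 1) e = 0 ∨ level κ s e < level κ (s + 1) e := by
  by_cases h : holder κ s e = holder κ (s + 1) e
  · by_cases h1 : holder κ (s + 1) e = decide ((s + 1) % 2 = 1)
    · right
      have h2 : level κ s e = 0 := by
        rw [decide_odd_succ] at h1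
        simp [level, h, h1]
      rw [h2]
      simp only [level, h1]
      simp only [ne_eq, not_true_eq_false, if_false]
      split_ifs <;> simp
    · left
      simp only [level, ne_eq, h1, not_false_eq_true, if_true]
  · right
    rw [level_eq_one h, level_succ_eq_two h]
    norm_num

/-- The best gain on item `e`, compensation included, against the bid at time `s`. -/
def bestLevel (κ s e : ℕ) : ℕ := if level κ s e = 0 then 2 else 1

theorem level_le_two (κ t e : ℕ) : level κ t e ≤ 2 := by
  unfold level; split_ifs <;> simp

/-- Against 0 the best replies are 1 and 2, against 2 they are 0 and 1, and against 1 all replies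
tie. Thus optimality is decided item by item. -/
theorem gain_le_bestLevel (κ s t e : ℕ) :
    compensation κ t e + (level κ t e - level κ s e) ≤ bestLevel κ s e := by
  have h1 := level_le_two κ t e
  unfold compensation bestLevel
  split_ifs <;> omega

theorem gain_succ_eq_bestLevel (κ s e : ℕ) :
    compensation κ (s + 1) e + (level κ (s + 1) e - level κ s e) = bestLevel κ s e := by
  have h1 := level_le_two κ (s + 1) e
  have h2 := level_outbid κ s e
  unfold compensation bestLevel
  by_cases h0 : level κ (s + 1) e = 0
  · have h3 : level κ s e ≠ 0 := by
      intro h3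
      have h4 : holder κ s e ≠ holder κ (s + 1) e ∨ holder κ s e = holder κ (s + 1) e := by tauto
      rcases h4 with h4 | h4
      · rw [level_eq_one h4] at h3; omega
      · have h5 : holder κ s e ≠ decide (s % 2 = 1) := by
          intro h5
          simp [level, h5, h4 ▸ h5] at h3
        have h6 : holder κ (s + 1) e = decide ((s + 1) % 2 = 1) := by
          rw [decide_odd_succ, ← h4]
          revert h5
          cases holder κ s e <;> cases decide (s % 2 = 1) <;> simp
        simp only [level, ← h6] at h0
        simp only [ne_eq, not_true_eq_false, if_false] at h0
        split_ifs at h0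
    split_ifs <;> omega
  · split_ifs <;> omega

/-- Both bidders keep the item or both lack it: the bids are 2 against 2 or 0 against 0, the two bad
replies. -/
theorem gain_lt_bestLevel {κ s t e : ℕ} (hpar : t % 2 ≠ s % 2)
    (hs : holder κ s e = holder κ (s + 1) e) (ht : holder κ t e = holder κ (t + 1) e)
    (hst : holder κ s e ≠ holder κ t e) :
    compensation κ t e + (level κ t e - level κ s e) < bestLevel κ s e := by
  unfold compensation bestLevel level
  rw [decide_odd_of_ne hpar, ← hs, ← ht]
  revert hst
  cases holder κ s e <;> cases holder κ t e <;> cases decide (s % 2 = 1) <;> simp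

theorem sum_gain_lt {κ s t : ℕ} (hs : s + 1 ≤ walkLength κ) (ht : t ≤ walkLength κ)
    (hpar : t % 2 ≠ s % 2) (hne : t ≠ s + 1) (hne' : t + 1 ≠ s) :
    ∑ e : Fin (κ + 5), (compensation κ t e + (level κ t e - level κ s e)) <
      ∑ e : Fin (κ + 5), bestLevel κ s e := by
  obtain ⟨e, he, h1, h2, h3⟩ : ∃ e < κ + 5, holder κ s e = holder κ (s + 1) e ∧
      holder κ t e = holder κ (t + 1) e ∧ holder κ s e ≠ holder κ t e := by
    rcases lt_or_ge s t with h | h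
    · exact holder_separation (by omega) ht hpar.symm
    · obtain ⟨e, he, h1, h2, h3⟩ := holder_separation (κ := κ) (i := t) (j := s) (by omega) (by omega) hpar
      exact ⟨e, he, h2, h1, h3.symm⟩
  exact Finset.sum_lt_sum (fun i _ => gain_le_bestLevel κ s t i)
    ⟨⟨e, he⟩, Finset.mem_univ _, gain_lt_bestLevel hpar h1 h2 h3⟩

theorem scaled_gain (κ M s t : ℕ) :
    M * ∑ e : Fin (κ + 5), compensation κ t e + t +
        ∑ e : Fin (κ + 5), (M * level κ t e - M * level κ s e) =
      M * ∑ e : Fin (κ + 5), (compensation κ t e + (level κ t e - level κ s e)) + t := by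
  simp only [Finset.sum_add_distrib, mul_add, Finset.mul_sum, Nat.mul_sub]
  ring

/-- A duel whose length is exponential in the number of items. -/
def longDuel (κ : ℕ) : Duel (κ + 5) (walkLength κ) where
  bid t e := (walkLength κ + 1) * level κ t e
  -- The unit `walkLength κ + 1` exceeds all times, so the summand `t` only breaks ties; it favours
  -- `s + 1` over `s - 1`.
  reserve t := (walkLength κ + 1) * ∑ e : Fin (κ + 5), compensation κ t e + t
  best s t hs ht hpar hne := by
    rw [scaled_gain, scaled_gain]
    simp only [gain_succ_eq_bestLevel]
    by_cases h : t + 1 = s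
    · have h1 := Finset.sum_le_sum (s := Finset.univ)
        fun (i : Fin (κ + 5)) _ => gain_le_bestLevel κ s t i
      have h2 := Nat.mul_le_mul_left (walkLength κ + 1) h1
      omega
    · have h1 := sum_gain_lt hs ht hpar hne h
      have h2 := Nat.mul_le_mul_left (walkLength κ + 1) (Nat.succ_le_of_lt h1)
      rw [Nat.succ_eq_add_one, Nat.mul_add] at h2
      omega
  outbid s _ e := by
    rcases level_outbid κ s e with h | h
    · left; simp [h]
    · right; gcongr
  progress s _ := by
    obtain ⟨e, he, h⟩ := holder_moves κ s
    refine ⟨⟨e, he⟩, fun h1 => ?_, ?_, ?_⟩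
    · obtain ⟨r, rfl⟩ : ∃ r, s = r + 1 := ⟨s - 1, by omega⟩
      simp [level_pred_eq_zero h]
    · simp [level_eq_one h]
    · simp only [level_eq_one h, level_succ_eq_two h]
      omega

/-- An upper bound on the total value of a vector of the duel. -/
def Duel.bound {K L : ℕ} (𝒟 : Duel K L) : ℕ :=
  ∑ t ∈ Finset.range (L + 1), (𝒟.reserve t + ∑ e, 𝒟.bid t e)

theorem Duel.le_bound {K L t : ℕ} (𝒟 : Duel K L) (ht : t ≤ L) :
    𝒟.reserve t + ∑ e, 𝒟.bid t e ≤ 𝒟.bound :=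
  Finset.single_le_sum (f := fun t => 𝒟.reserve t + ∑ e, 𝒟.bid t e) (fun _ _ => Nat.zero_le _)
    (Finset.mem_range.2 (Nat.lt_succ_of_le ht))

/-! ### Forced best replies for XOS valuations. -/

namespace XOSInstance

variable {n m : ℕ} (I : XOSInstance n m)

theorem sum_weight_le_value (i : Fin n) (ℓ : Fin (I.clauses i + 1)) (S : Finset (Fin m)) :
    ∑ j ∈ S, I.weight i ℓ j ≤ I.value i S :=
  Finset.le_sup (f := fun ℓ => ∑ j ∈ S, I.weight i ℓ j) (Finset.mem_univ ℓ)

theorem exists_value_eq (i : Fin n) (S : Finset (Fin m)) :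
    ∃ ℓ, I.value i S = ∑ j ∈ S, I.weight i ℓ j := by
  obtain ⟨ℓ, -, h⟩ := Finset.exists_mem_eq_sup Finset.univ Finset.univ_nonempty
    (fun ℓ => ∑ j ∈ S, I.weight i ℓ j)
  exact ⟨ℓ, h⟩

/-- The most that agent `i` can gain with clause `ℓ` at the current prices. -/
noncomputable def gain (b : Bids n m) (i : Fin n) (ℓ : Fin (I.clauses i + 1)) : ℝ :=
  ∑ j, max ((I.weight i ℓ j : ℝ) - price b i j) 0

theorem sum_sub_le_gain (b : Bids n m) (i : Fin n) (ℓ : Fin (I.clauses i + 1))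
    (S : Finset (Fin m)) :
    ∑ j ∈ S, ((I.weight i ℓ j : ℝ) - price b i j) ≤ I.gain b i ℓ :=
  (Finset.sum_le_sum fun _ _ => le_max_left _ _).trans
    (Finset.sum_le_sum_of_subset_of_nonneg (Finset.subset_univ S) fun _ _ _ => le_max_right _ _)

theorem sum_sub_lt_gain {b : Bids n m} {i : Fin n} {ℓ : Fin (I.clauses i + 1)}
    {S : Finset (Fin m)} {j : Fin m} (hj : j ∉ S) (h : price b i j < I.weight i ℓ j) :
    ∑ j ∈ S, ((I.weight i ℓ j : ℝ) - price b i j) < I.gain b i ℓ := by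
  refine (Finset.sum_le_sum fun _ _ => le_max_left _ (0 : ℝ)).trans_lt
    (Finset.sum_lt_sum_of_subset (Finset.subset_univ S) (Finset.mem_univ j) hj ?_
      fun _ _ _ => le_max_right _ _)
  exact lt_max_of_lt_left (sub_pos.2 (NNReal.coe_lt_coe.2 h))

theorem surplus_eq_of_value_eq {b : Bids n m} {i : Fin n} {ℓ : Fin (I.clauses i + 1)}
    {S : Finset (Fin m)} (h : I.value i S = ∑ j ∈ S, I.weight i ℓ j) :
    surplus I b i S = ∑ j ∈ S, ((I.weight i ℓ j : ℝ) - price b i j) := by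
  rw [surplus, h, Finset.sum_sub_distrib, NNReal.coe_sum]

theorem sum_sub_le_surplus (b : Bids n m) (i : Fin n) (ℓ : Fin (I.clauses i + 1))
    (S : Finset (Fin m)) :
    ∑ j ∈ S, ((I.weight i ℓ j : ℝ) - price b i j) ≤ surplus I b i S := by
  rw [surplus, Finset.sum_sub_distrib, ← NNReal.coe_sum]
  gcongr
  exact I.sum_weight_le_value i ℓ S

end XOSInstance

theorem price_update_self {n m : ℕ} (b : Bids n m) (i : Fin n) (c : Fin m → ℝ≥0) (j : Fin m) :
    price (Function.update b i c) i j = price b i j := by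
  unfold price
  refine Finset.sup_congr rfl fun i' hi' => ?_
  rw [Function.update_of_ne (Finset.ne_of_mem_erase hi')]

theorem le_price {n m : ℕ} (b : Bids n m) {i i' : Fin n} (h : i' ≠ i) (j : Fin m) :
    b i' j ≤ price b i j :=
  Finset.le_sup (f := fun i' => b i' j) (Finset.mem_erase.2 ⟨h, Finset.mem_univ i'⟩)

theorem AllocationRule.mem_won {n m : ℕ} (R : AllocationRule n m) (b : Bids n m) (i : Fin n)
    (j : Fin m) : j ∈ R.won b i ↔ R.winner b j = i := by
  simp [AllocationRule.won]

theorem AllocationRule.mem_won_of_price_lt {n m : ℕ} (R : AllocationRule n m) {b : Bids n m}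
    {i : Fin n} {j : Fin m} (h : price b i j < b i j) : j ∈ R.won b i := by
  rw [R.mem_won]
  by_contra h1
  exact absurd ((R.highest b j i).trans (le_price b h1 j)) (not_le.2 h)

theorem AllocationRule.price_le_of_mem_won {n m : ℕ} (R : AllocationRule n m) {b : Bids n m}
    {i : Fin n} {j : Fin m} (h : j ∈ R.won b i) : price b i j ≤ b i j := by
  rw [R.mem_won] at h
  refine Finset.sup_le fun i' _ => ?_
  have := R.highest b j i'
  rwa [h] at this

section BestReply

variable {n m : ℕ} {I : XOSInstance n m} {R : AllocationRule n m} {b : Bids n m} {i : Fin n}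
  {ℓ : Fin (I.clauses i + 1)}

/-- `hbest` compares weights, not indices, because `duelInstance` lists some clauses repeatedly. -/
theorem surplus_lt_gain (hbest : ∀ ℓ', I.weight i ℓ' = I.weight i ℓ ∨ I.gain b i ℓ' < I.gain b i ℓ)
    {S : Finset (Fin m)} {j : Fin m} (hj : j ∉ S) (hw : price b i j < I.weight i ℓ j) :
    surplus I b i S < I.gain b i ℓ := by
  obtain ⟨ℓ', h⟩ := I.exists_value_eq i S
  rw [I.surplus_eq_of_value_eq h]
  rcases hbest ℓ' with h | h
  · rw [h]
    exact I.sum_sub_lt_gain hj hw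
  · exact (I.sum_sub_le_gain b i ℓ' S).trans_lt h

/-- Tie-breaking is harmless: positive bids win strictly, and an item won with bid zero has price
zero. -/
theorem gain_le_utility_update (hout : ∀ j, I.weight i ℓ j = 0 ∨ price b i j < I.weight i ℓ j) :
    I.gain b i ℓ ≤ utility R I (Function.update b i (I.weight i ℓ)) i := by
  unfold utility
  refine le_trans ?_ (I.sum_sub_le_surplus _ i ℓ _)
  unfold XOSInstance.gain
  rw [← Finset.sum_subset (Finset.subset_univ (R.won (Function.update b i (I.weight i ℓ)) i))]
  · refine Finset.sum_le_sum fun j hj => ?_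
    have h := R.price_le_of_mem_won hj
    rw [Function.update_self] at h
    rw [price_update_self] at h ⊢
    exact max_le le_rfl (sub_nonneg.2 (NNReal.coe_le_coe.2 h))
  · intro j _ hj
    rcases hout j with h | h
    · simp [h]
    · refine absurd (R.mem_won_of_price_lt ?_) hj
      rw [price_update_self, Function.update_self]
      exact h

/-- At the item of `hgain` the agent is strictly outbid, hence does not win it under any
tie-breaking, although the best clause wants it at its price. -/
theorem not_isBestResponse
    (hbest : ∀ ℓ', I.weight i ℓ' = I.weight i ℓ ∨ I.gain b i ℓ' < I.gain b i ℓ)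
    (hout : ∀ j, I.weight i ℓ j = 0 ∨ price b i j < I.weight i ℓ j)
    (hgain : ∃ j, b i j < price b i j ∧ price b i j < I.weight i ℓ j) :
    ¬ IsBestResponse R I b i := by
  intro h
  obtain ⟨j, hj1, hj2⟩ := hgain
  have h1 : utility R I b i < I.gain b i ℓ :=
    surplus_lt_gain hbest (fun hj => absurd (R.price_le_of_mem_won hj) (not_le.2 hj1)) hj2
  exact absurd (h (I.weight i ℓ)) (not_le.2 (h1.trans_le (gain_le_utility_update hout)))

/-- If clause `ℓ` is the unique best one at the current prices and all its bids are serious, then an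
agent that is not yet playing a best response changes its bid to this clause. -/
theorem eq_update_of_potentialStep
    (hbest : ∀ ℓ', I.weight i ℓ' = I.weight i ℓ ∨ I.gain b i ℓ' < I.gain b i ℓ)
    (hout : ∀ j, I.weight i ℓ j = 0 ∨ price b i j < I.weight i ℓ j)
    (hnot : ¬ IsBestResponse R I b i) {b' : Bids n m} (hstep : PotentialStep R I i b b') :
    b' = Function.update b i (I.weight i ℓ) := by
  rcases hstep with ⟨h, -⟩ | ⟨-, D, ℓ', hD, hval, rfl⟩
  · exact absurd h hnot
  have hge : I.gain b i ℓ ≤ surplus I b i D := by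
    refine (gain_le_utility_update (R := R) hout).trans ?_
    refine le_trans (le_of_eq ?_) (hD (R.won (Function.update b i (I.weight i ℓ)) i))
    simp only [utility, surplus, price_update_self]
  rw [I.surplus_eq_of_value_eq hval.symm] at hge
  have hw : I.weight i ℓ' = I.weight i ℓ := by
    rcases hbest ℓ' with h | h
    · exact h
    · exact absurd (hge.trans (I.sum_sub_le_gain b i ℓ' D)) (not_le.2 h)
  rw [hw] at hge ⊢
  congr 1
  funext j
  -- Omitting an item of positive weight would lose surplus, so cutting the clause down to `D`
  -- changes nothing.
  split_ifs with hj
  · rfl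
  · rcases hout j with h | h
    · exact h.symm
    · exact absurd hge (not_le.2 (I.sum_sub_lt_gain hj h))

end BestReply

/-! ### Groups of items and the clauses on them. -/

/-- The items of one group: a big item, two auxiliary items, and `K` items to fight for. -/
inductive Slot (K : ℕ) : Type
  | big : Slot K
  | base : Slot K
  | key : Slot K
  | tiny : Fin K → Slot K

/-- The items of a group, as an iterated `Option` type. -/
def Slot.equivOption (K : ℕ) : Slot K ≃ Option (Option (Option (Fin K))) where
  toFun
    | .big => none
    | .base => some none
    | .key => some (some none)
    | .tiny e => some (some (some e))
  invFun
    | none => .big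
    | some none => .base
    | some (some none) => .key
    | some (some (some e)) => .tiny e
  left_inv x := by cases x <;> rfl
  right_inv x := by rcases x with _ | _ | _ | _ <;> rfl

instance (K : ℕ) : Fintype (Slot K) := Fintype.ofEquiv _ (Slot.equivOption K).symm

theorem Slot.card (K : ℕ) : Fintype.card (Slot K) = K + 3 := by
  rw [Fintype.card_congr (Slot.equivOption K)]
  simp

theorem Slot.sum_eq {K : ℕ} {M : Type*} [AddCommMonoid M] (f : Slot K → M) :
    ∑ x, f x = f .big + (f .base + (f .key + ∑ e, f (.tiny e))) := by
  rw [← Equiv.sum_comp (Slot.equivOption K).symm f, Fintype.sum_option, Fintype.sum_option,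
    Fintype.sum_option]
  rfl

section Weights

variable {N K L : ℕ} (𝒟 : Duel K L) (B : ℕ)

/-- A number exceeding all values in the duel. -/
def Duel.gap : ℕ := 𝒟.bound + 1

/-- The value of the key item of a group, which makes up for all differences between groups. -/
def Duel.lure (N : ℕ) : ℕ := (N + 1) * 𝒟.gap

/-- The `t`-th bid vector of the agent who owns group `j`. -/
def lowWeight (j t : ℕ) (y : Fin N × Slot K) : ℕ :=
  if (y.1 : ℕ) = j then
    match y.2 with
    | .big => 0
    | .base => 𝒟.reserve t + if t = L then 0 else 𝒟.lure N
    | .key => if t = L then 2 * 𝒟.lure N else 0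
    | .tiny e => 𝒟.bid t e
  else 0

/-- The `t`-th bid vector, on group `j`, of the agent who fights with all other agents in turn. -/
def topWeight (j t : ℕ) (y : Fin N × Slot K) : ℕ :=
  match y.2 with
  | .big => if (y.1 : ℕ) = j then B + (N - j) * 𝒟.gap + 𝒟.reserve t else 1
  | .base => 0
  | .key => if (y.1 : ℕ) = j then 𝒟.lure N else 0
  | .tiny e => if (y.1 : ℕ) = j then 𝒟.bid t e else 0

/-- The clause that lets the owner of group `j` get a high value from the big item. -/
def ownWeight (j : ℕ) (y : Fin N × Slot K) : ℕ :=
  match y.2 with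
  | .big => if (y.1 : ℕ) = j then B else 0
  | _ => 0

/-- The clause with bid one on every big item. -/
def flatWeight (y : Fin N × Slot K) : ℕ :=
  match y.2 with
  | .big => 1
  | _ => 0

theorem sum_ite_add_one (j : Fin N) (G : ℕ) :
    ∑ j' : Fin N, (if (j' : ℕ) = j then G else 1) + 1 = G + N := by
  have h : ∀ j' : Fin N, (if (j' : ℕ) = j then G else 1) + (if j' = j then 1 else 0) =
      (if j' = j then G else 0) + 1 := by
    intro j'
    by_cases h : j' = j
    · simp [h]
    · simp [h, Fin.val_ne_of_ne h]
  have h2 := Finset.sum_congr (rfl : (Finset.univ : Finset (Fin N)) = _) fun j' _ => h j'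
  simpa [Finset.sum_add_distrib] using h2

/-- The value of group `j` for the fighting agent, if the owner of the group is at time `s`. -/
def topCore (j s t : ℕ) : ℕ :=
  B + (N - j) * 𝒟.gap + 𝒟.reserve t + (𝒟.lure N - if s = L then 2 * 𝒟.lure N else 0) +
    ∑ e, (𝒟.bid t e - 𝒟.bid s e)

/-- The other big items add `N - 1` for every `j`, so comparing clauses means comparing `topCore`.
-/
theorem sum_topWeight_sub (v : ℕ → ℕ) (j : Fin N) (t : ℕ) :
    ∑ y : Fin N × Slot K, (topWeight 𝒟 B j t y - lowWeight 𝒟 y.1 (v y.1) y) + 1 =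
      topCore 𝒟 B (N := N) j (v j) t + N := by
  rw [← sum_ite_add_one j, Fintype.sum_prod_type]
  congr 1
  refine Finset.sum_congr rfl fun j' _ => ?_
  rw [Slot.sum_eq]
  by_cases h : (j' : ℕ) = j
  · simp only [topWeight, lowWeight, topCore, h, if_true]
    omega
  · simp [topWeight, lowWeight, h]

theorem sum_flatWeight_sub (v : ℕ → ℕ) :
    ∑ y : Fin N × Slot K, (flatWeight y - lowWeight 𝒟 y.1 (v y.1) y) = N := by
  rw [Fintype.sum_prod_type]
  simp [Slot.sum_eq, flatWeight, lowWeight]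

theorem sum_group_eq (j : Fin N) (f : Fin N × Slot K → ℕ) (hf : ∀ y, y.1 ≠ j → f y = 0) :
    ∑ y, f y = ∑ x, f (j, x) := by
  rw [Fintype.sum_prod_type]
  refine Finset.sum_eq_single j (fun j' _ hj' => ?_) (by simp)
  exact Finset.sum_eq_zero fun x _ => hf (j', x) hj'

/-- The key item at `t = L` nets `2 * lure - lure`, exactly the bonus on the base item at other
times. Ending the duel thus leaves the owner's incentives untouched. -/
theorem sum_lowWeight_sub (j : Fin N) (s t : ℕ) :
    ∑ y : Fin N × Slot K, (lowWeight 𝒟 j t y - topWeight 𝒟 B j s y) =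
      𝒟.lure N + (𝒟.reserve t + ∑ e, (𝒟.bid t e - 𝒟.bid s e)) := by
  rw [sum_group_eq j _ fun y hy => by simp [lowWeight, Fin.val_ne_of_ne hy], Slot.sum_eq]
  simp only [lowWeight, topWeight, if_true]
  split_ifs <;> omega

theorem sum_ownWeight_sub (j : Fin N) (s : ℕ) :
    ∑ y : Fin N × Slot K, (ownWeight B j y - topWeight 𝒟 B j s y) = 0 := by
  refine Finset.sum_eq_zero fun y _ => ?_
  rcases y with ⟨j', _ | _ | _ | e⟩
  · simp only [ownWeight, topWeight]
    split_ifs <;> omega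
  all_goals simp [ownWeight]

theorem Duel.core_le {s t : ℕ} (ht : t ≤ L) :
    𝒟.reserve t + ∑ e, (𝒟.bid t e - 𝒟.bid s e) ≤ 𝒟.bound := by
  refine le_trans ?_ (𝒟.le_bound ht)
  gcongr
  exact Nat.sub_le _ _

/-- A finished group no longer offers the key item, and `lure` exceeds all position bonuses and duel
values together. -/
theorem topCore_lt_of_left {j j' s t : ℕ} (hs : s < L) (ht : t ≤ L) :
    topCore 𝒟 B (N := N) j' L t < topCore 𝒟 B (N := N) j s (s + 1) := by
  have h := 𝒟.core_le (s := L) ht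
  have h1 : (N - (j' : ℕ)) * 𝒟.gap ≤ N * 𝒟.gap := Nat.mul_le_mul_right _ (Nat.sub_le _ _)
  have h2 : 𝒟.lure N = N * 𝒟.gap + (𝒟.bound + 1) := by
    rw [Duel.lure, Nat.add_mul, one_mul, Duel.gap]
  simp only [topCore, if_true, hs.ne, if_false]
  omega

/-- One position is worth `gap`, more than anything gained within a duel. -/
theorem topCore_lt_of_gt {j j' : Fin N} {s t : ℕ} (hj : j < j') (hs : s < L) (ht : t ≤ L) :
    topCore 𝒟 B (N := N) j' 0 t < topCore 𝒟 B (N := N) j s (s + 1) := by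
  have h := 𝒟.core_le (s := 0) ht
  have h1 : (N - (j' : ℕ)) * 𝒟.gap + (𝒟.bound + 1) ≤ (N - (j : ℕ)) * 𝒟.gap := by
    change _ + 𝒟.gap ≤ _
    rw [← Nat.succ_mul]
    exact Nat.mul_le_mul_right _ (by omega)
  have h0 : (0 : ℕ) ≠ L := by omega
  simp only [topCore, hs.ne, h0, if_false]
  omega

theorem topCore_lt_of_ne {j s t : ℕ} (hs : s < L) (ht : t ≤ L) (hpar : t % 2 ≠ s % 2)
    (hne : t ≠ s + 1) :
    topCore 𝒟 B (N := N) j s t < topCore 𝒟 B (N := N) j s (s + 1) := by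
  have h := 𝒟.best s t hs ht hpar hne
  simp only [topCore, hs.ne, if_false]
  omega

theorem lowWeight_ne {j t : ℕ} {y : Fin N × Slot K} (h : (y.1 : ℕ) ≠ j) :
    lowWeight 𝒟 j t y = 0 := by
  simp [lowWeight, h]

theorem topWeight_outbids {j : Fin N} {v : ℕ → ℕ} (hs : v j < L) (y : Fin N × Slot K)
    (hB : 0 < B) : topWeight 𝒟 B j (v j + 1) y = 0 ∨
      lowWeight 𝒟 y.1 (v y.1) y < topWeight 𝒟 B j (v j + 1) y := by
  rcases y with ⟨j', _ | _ | _ | e⟩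
  · right
    simp only [lowWeight, topWeight, if_true]
    split_ifs <;> omega
  · simp [topWeight]
  · by_cases h : (j' : ℕ) = j
    · right
      simp only [lowWeight, topWeight, h, hs.ne, if_true, if_false]
      exact Nat.mul_pos (Nat.succ_pos _) (Nat.succ_pos _)
    · simp [topWeight, h]
  · by_cases h : (j' : ℕ) = j
    · simp only [lowWeight, topWeight, h, if_true]
      exact 𝒟.outbid _ hs e
    · simp [topWeight, h]

theorem lowWeight_outbids {j : Fin N} {s : ℕ} (hs : s < L) (y : Fin N × Slot K) :
    lowWeight 𝒟 j (s + 1) y = 0 ∨ topWeight 𝒟 B j s y < lowWeight 𝒟 j (s + 1) y := by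
  by_cases h : (y.1 : ℕ) = j
  · rcases y with ⟨j', _ | _ | _ | e⟩
    · simp [lowWeight]
    · simp only [lowWeight, topWeight]
      exact Nat.eq_zero_or_pos _
    · have h0 : 0 < 𝒟.lure N := Nat.mul_pos (Nat.succ_pos _) (Nat.succ_pos _)
      simp only [lowWeight, topWeight] at h ⊢
      simp only [h, if_true]
      split_ifs
      · right; omega
      · left; rfl
    · simp only [lowWeight, topWeight] at h ⊢
      simp only [h, if_true]
      exact 𝒟.outbid _ hs e
  · left; exact lowWeight_ne 𝒟 h

end Weights

/-! ### The instance and its forced steps. -/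

section Instance

variable {N K l m : ℕ} (𝒟 : Duel K (2 * l)) (B : ℕ) (σ : Fin m ≃ Fin N × Slot K)

/-- The clauses of agent `i`, where the last agent is the one who fights with all others. -/
def clauseWeight (i : Fin (N + 1)) (c : Option (Option (Fin N × Fin l))) :
    Fin N × Slot K → ℕ :=
  Fin.lastCases (motive := fun _ => Fin N × Slot K → ℕ)
    (match c with
      | none => flatWeight
      | some none => flatWeight
      | some (some (j, q)) => topWeight 𝒟 B j (2 * q + 1))
    (fun j => match c with
      | none => ownWeight B j
      | some none => lowWeight 𝒟 j 0
      | some (some (_, q)) => lowWeight 𝒟 j (2 * q + 2)) i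

/-- The indices of the clauses. -/
noncomputable def clauseEquiv (N l : ℕ) :
    Option (Option (Fin N × Fin l)) ≃ Fin (Fintype.card (Option (Fin N × Fin l)) + 1) :=
  Fintype.equivFinOfCardEq Fintype.card_option

/-- The instance in which the last agent fights with all others in turn. -/
noncomputable def duelInstance : XOSInstance (N + 1) m where
  clauses _ := Fintype.card (Option (Fin N × Fin l))
  weight i ℓ x := (clauseWeight 𝒟 B i ((clauseEquiv N l).symm ℓ) (σ x) : ℕ)

theorem duelInstance_weight (i : Fin (N + 1)) (c : Option (Option (Fin N × Fin l))) (x : Fin m) :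
    (duelInstance 𝒟 B σ).weight i (clauseEquiv N l c) x = (clauseWeight 𝒟 B i c (σ x) : ℕ) := by
  simp [duelInstance]

/-- Prices are needed only where the clause is nonzero; for an owner this is its own group. -/
theorem duelInstance_gain {b : Bids (N + 1) m} {i : Fin (N + 1)}
    {c : Option (Option (Fin N × Fin l))} {p : Fin N × Slot K → ℕ}
    (hp : ∀ x, clauseWeight 𝒟 B i c (σ x) = 0 ∨ price b i x = p (σ x)) :
    (duelInstance 𝒟 B σ).gain b i (clauseEquiv N l c) =
      ((∑ y, (clauseWeight 𝒟 B i c y - p y) : ℕ) : ℝ) := by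
  rw [← Equiv.sum_comp σ, Nat.cast_sum]
  refine Finset.sum_congr rfl fun x _ => ?_
  rw [duelInstance_weight]
  rcases hp x with h | h
  · simp [h]
  · rw [h, NNReal.coe_natCast, NNReal.coe_natCast]
    rcases le_total (clauseWeight 𝒟 B i c (σ x)) (p (σ x)) with h1 | h1
    · rw [Nat.sub_eq_zero_of_le h1, Nat.cast_zero, max_eq_right (sub_nonpos.2 (Nat.cast_le.2 h1))]
    · rw [Nat.cast_sub h1, max_eq_left (sub_nonneg.2 (Nat.cast_le.2 h1))]

end Instance

section Steps

variable {N K l m : ℕ} {𝒟 : Duel K (2 * l)} {B : ℕ} {σ : Fin m ≃ Fin N × Slot K}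
  {R : AllocationRule (N + 1) m} {b : Bids (N + 1) m} {v : ℕ → ℕ}

/-- The owners of the groups bid their vectors of the times `v`. -/
def LowBids (𝒟 : Duel K (2 * l)) (σ : Fin m ≃ Fin N × Slot K) (v : ℕ → ℕ)
    (b : Bids (N + 1) m) : Prop :=
  ∀ (j : Fin N) (x : Fin m), b j.castSucc x = (lowWeight 𝒟 j (v j) (σ x) : ℕ)

theorem LowBids.price_last (h : LowBids 𝒟 σ v b) (x : Fin m) :
    price b (Fin.last N) x = (lowWeight 𝒟 (σ x).1 (v (σ x).1) (σ x) : ℕ) := by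
  refine le_antisymm (Finset.sup_le fun i hi => ?_) ?_
  · obtain ⟨j, rfl⟩ := Fin.exists_castSucc_eq.2 (Finset.ne_of_mem_erase hi)
    rw [h]
    by_cases hj : ((σ x).1 : ℕ) = j
    · rw [hj]
    · rw [lowWeight_ne 𝒟 hj]
      simp
  · rw [← h]
    exact le_price b (Fin.castSucc_lt_last _).ne x

theorem LowBids.price_castSucc (h : LowBids 𝒟 σ v b) {j : Fin N} {x : Fin m} (hj : (σ x).1 = j) :
    price b j.castSucc x = b (Fin.last N) x := by
  refine le_antisymm (Finset.sup_le fun i hi => ?_) (le_price b (Fin.castSucc_lt_last _).ne' x)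
  induction i using Fin.lastCases with
  | last => exact le_rfl
  | cast j' =>
    have hne : j' ≠ j := fun h1 => Finset.ne_of_mem_erase hi (by rw [h1])
    rw [h, lowWeight_ne 𝒟 (by rw [hj]; exact Fin.val_ne_of_ne hne.symm)]
    simp

theorem clauseWeight_last_some (j : Fin N) (q : Fin l) :
    clauseWeight 𝒟 B (Fin.last N) (some (some (j, q))) = topWeight 𝒟 B j (2 * q + 1) := by
  simp [clauseWeight]

theorem clauseWeight_castSucc_some (j j' : Fin N) (q : Fin l) :
    clauseWeight 𝒟 B j.castSucc (some (some (j', q))) = lowWeight 𝒟 j (2 * q + 2) := by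
  simp [clauseWeight]

theorem duelInstance_weight_eq (i : Fin (N + 1)) (c : Option (Option (Fin N × Fin l))) :
    (duelInstance 𝒟 B σ).weight i (clauseEquiv N l c) =
      fun x => ((clauseWeight 𝒟 B i c (σ x) : ℕ) : ℝ≥0) :=
  funext fun _ => duelInstance_weight 𝒟 B σ i c _

/-- A dominating clause of the instance `duelInstance` determines the next step. -/
theorem duelInstance_step {i : Fin (N + 1)} {c : Option (Option (Fin N × Fin l))}
    {p : Fin N × Slot K → ℕ} (hp : ∀ c x, clauseWeight 𝒟 B i c (σ x) = 0 ∨ price b i x = p (σ x))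
    (hbest : ∀ c', clauseWeight 𝒟 B i c' = clauseWeight 𝒟 B i c ∨
      ∑ y, (clauseWeight 𝒟 B i c' y - p y) < ∑ y, (clauseWeight 𝒟 B i c y - p y))
    (hout : ∀ y, clauseWeight 𝒟 B i c y = 0 ∨ p y < clauseWeight 𝒟 B i c y)
    {x : Fin m} (hx : b i x < p (σ x)) (hx' : p (σ x) < clauseWeight 𝒟 B i c (σ x)) :
    ¬ IsBestResponse R (duelInstance 𝒟 B σ) b i ∧
      ∀ b', PotentialStep R (duelInstance 𝒟 B σ) i b b' →
        b' = Function.update b i fun x => ((clauseWeight 𝒟 B i c (σ x) : ℕ) : ℝ≥0) := by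
  have hbest' : ∀ ℓ', (duelInstance 𝒟 B σ).weight i ℓ' =
        (duelInstance 𝒟 B σ).weight i (clauseEquiv N l c) ∨
      (duelInstance 𝒟 B σ).gain b i ℓ' < (duelInstance 𝒟 B σ).gain b i (clauseEquiv N l c) := by
    intro ℓ'
    obtain ⟨c', rfl⟩ := (clauseEquiv N l).surjective ℓ'
    rcases hbest c' with h | h
    · left
      rw [duelInstance_weight_eq, duelInstance_weight_eq, h]
    · right
      rw [duelInstance_gain 𝒟 B σ (hp c'), duelInstance_gain 𝒟 B σ (hp c)]
      exact_mod_cast h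
  have hout' : ∀ x, (duelInstance 𝒟 B σ).weight i (clauseEquiv N l c) x = 0 ∨
      price b i x < (duelInstance 𝒟 B σ).weight i (clauseEquiv N l c) x := by
    intro x
    rw [duelInstance_weight]
    rcases hp c x with h | h
    · left; simp [h]
    · rw [h]
      rcases hout (σ x) with h | h
      · left; simp [h]
      · right; exact_mod_cast h
  have hnot : ¬ IsBestResponse R (duelInstance 𝒟 B σ) b i := by
    refine not_isBestResponse hbest' hout' ⟨x, ?_⟩
    rw [duelInstance_weight]
    rcases hp c x with h | h
    · omega
    · rw [h]
      exact ⟨hx, by exact_mod_cast hx'⟩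
  refine ⟨hnot, fun b' hb' => ?_⟩
  rw [eq_update_of_potentialStep hbest' hout' hnot hb', duelInstance_weight_eq]

/-- The step of the fighting agent. -/
theorem top_step (hB : 2 ≤ B) (hlow : LowBids 𝒟 σ v b) {j : Fin N} {q : ℕ} (hq : q < l)
    (hv : v j = 2 * q) (hlt : ∀ j' < (j : ℕ), v j' = 2 * l) (hgt : ∀ j' > (j : ℕ), v j' = 0)
    (hbid : ∀ e, (1 ≤ 2 * q → 𝒟.bid (2 * q - 1) e = 0) →
      b (Fin.last N) (σ.symm (j, .tiny e)) = 0) :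
    ¬ IsBestResponse R (duelInstance 𝒟 B σ) b (Fin.last N) ∧
      ∀ b', PotentialStep R (duelInstance 𝒟 B σ) (Fin.last N) b b' →
        b' = Function.update b (Fin.last N)
          fun x => ((topWeight 𝒟 B j (2 * q + 1) (σ x) : ℕ) : ℝ≥0) := by
  have key := duelInstance_step (R := R) (𝒟 := 𝒟) (B := B) (b := b) (σ := σ) (i := Fin.last N)
    (c := some (some (j, ⟨q, hq⟩))) (p := fun y => lowWeight 𝒟 y.1 (v y.1) y)
    (fun _ x => Or.inr (hlow.price_last x))
  rw [clauseWeight_last_some] at key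
  dsimp only at key
  obtain ⟨e, he, he1, he2⟩ := 𝒟.progress (2 * q) (by omega)
  have hmain := sum_topWeight_sub 𝒟 B v j (2 * q + 1)
  refine key ?_ ?_ (x := σ.symm (j, .tiny e)) ?_ ?_
  · have hflat : ∑ y : Fin N × Slot K, (flatWeight y - lowWeight 𝒟 y.1 (v y.1) y) <
        ∑ y : Fin N × Slot K, (topWeight 𝒟 B j (2 * q + 1) y - lowWeight 𝒟 y.1 (v y.1) y) := by
      rw [sum_flatWeight_sub]
      have : B ≤ topCore 𝒟 B (N := N) j (v j) (2 * q + 1) := by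
        simp only [topCore]; omega
      omega
    rintro (_ | _ | ⟨j', q'⟩)
    · right; simpa [clauseWeight] using hflat
    · right; simpa [clauseWeight] using hflat
    · rw [clauseWeight_last_some]
      have hmain' := sum_topWeight_sub 𝒟 B v j' (2 * q' + 1)
      by_cases hne : j' = j ∧ (q' : ℕ) = q
      · left; rw [hne.1, hne.2]
      · right
        suffices h : topCore 𝒟 B (N := N) j' (v j') (2 * q' + 1) <
            topCore 𝒟 B (N := N) j (v j) (2 * q + 1) by omega
        have hq' := q'.2
        rw [hv]
        rcases lt_trichotomy j' j with h | rfl | h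
        · rw [hlt j' h]
          exact topCore_lt_of_left 𝒟 B (by omega) (by omega)
        · rw [hv]
          exact topCore_lt_of_ne 𝒟 B (by omega) (by omega) (by omega)
            (fun h => hne ⟨rfl, by omega⟩)
        · rw [hgt j' h]
          exact topCore_lt_of_gt 𝒟 B h (by omega) (by omega)
  · intro y
    rw [← hv]
    exact topWeight_outbids 𝒟 B (by omega) y (by omega)
  · rw [hbid e he]
    simpa [lowWeight, hv] using he1
  · simpa [lowWeight, topWeight, hv] using he2

/-- The step of the owner of group `j`. -/
theorem low_step (hlow : LowBids 𝒟 σ v b) {j : Fin N} {q : ℕ} (hq : q < l)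
    (hv : v j = 2 * q)
    (hbid : ∀ x, b (Fin.last N) x = (topWeight 𝒟 B j (2 * q + 1) (σ x) : ℕ)) :
    ¬ IsBestResponse R (duelInstance 𝒟 B σ) b j.castSucc ∧
      ∀ b', PotentialStep R (duelInstance 𝒟 B σ) j.castSucc b b' →
        b' = Function.update b j.castSucc
          fun x => ((lowWeight 𝒟 j (2 * q + 2) (σ x) : ℕ) : ℝ≥0) := by
  have key := duelInstance_step (R := R) (B := B) (i := j.castSucc) (b := b) (σ := σ)
    (c := some (some (j, ⟨q, hq⟩))) (p := fun y => topWeight 𝒟 B j (2 * q + 1) y) (by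
      intro c x
      by_cases hx : (σ x).1 = j
      · right
        rw [hlow.price_castSucc hx, hbid]
      · left
        have hx' := Fin.val_ne_of_ne hx
        rcases c with _ | _ | ⟨j', q'⟩
        · have hσ : clauseWeight 𝒟 B j.castSucc none (σ x) = ownWeight B j (σ x) := by
            simp [clauseWeight]
          rw [hσ, ownWeight]
          split
          · exact if_neg hx'
          · rfl
        · simpa [clauseWeight] using lowWeight_ne 𝒟 hx'
        · rw [clauseWeight_castSucc_some]
          exact lowWeight_ne 𝒟 hx')
  rw [clauseWeight_castSucc_some] at key
  dsimp only at key
  obtain ⟨e, he, he1, he2⟩ := 𝒟.progress (2 * q + 1) (by omega)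
  have hpos : 0 < 𝒟.lure N := Nat.mul_pos (Nat.succ_pos _) (Nat.succ_pos _)
  have hbest : ∀ t, t ≤ 2 * l → t % 2 = 0 → t ≠ 2 * q + 2 →
      ∑ y : Fin N × Slot K, (lowWeight 𝒟 j t y - topWeight 𝒟 B j (2 * q + 1) y) <
        ∑ y : Fin N × Slot K, (lowWeight 𝒟 j (2 * q + 2) y - topWeight 𝒟 B j (2 * q + 1) y) := by
    intro t ht hpar hne
    rw [sum_lowWeight_sub, sum_lowWeight_sub]
    exact Nat.add_lt_add_left (𝒟.best (2 * q + 1) t (by omega) ht (by omega) hne) _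
  refine key ?_ ?_ (x := σ.symm (j, .tiny e)) ?_ ?_
  · rintro (_ | _ | ⟨j', q'⟩)
    · right
      have h : clauseWeight 𝒟 B j.castSucc none = ownWeight B j := by simp [clauseWeight]
      rw [h, sum_ownWeight_sub, sum_lowWeight_sub]
      omega
    · right
      have h : clauseWeight 𝒟 B j.castSucc (some none) = lowWeight 𝒟 j 0 := by simp [clauseWeight]
      rw [h]
      exact hbest 0 (by omega) rfl (by omega)
    · rw [clauseWeight_castSucc_some]
      have hq' := q'.2
      by_cases hne : (q' : ℕ) = q
      · left; rw [hne]
      · right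
        exact hbest _ (by omega) (by omega) (by omega)
  · exact fun y => lowWeight_outbids 𝒟 B (by omega) y
  · rw [hlow]
    simp only [Nat.add_sub_cancel] at he
    simp [lowWeight, topWeight, hv, he, he1]
  · simpa [lowWeight, topWeight] using he2

end Steps

/-! ### Phases of the run and activation counts. -/

section Run

variable {N K l m : ℕ} {𝒟 : Duel K (2 * l)} {B : ℕ} {σ : Fin m ≃ Fin N × Slot K}
  {R : AllocationRule (N + 1) m} {b : Bids (N + 1) m}

/-- How far the owner of group `j'` has got after `r` steps of phase `j`. -/
def progressAt (l j r j' : ℕ) : ℕ :=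
  if j' < j then 2 * l else if j' = j then 2 * (r / 2) else 0

/-- The bids after `r` steps of phase `j`, in which the last agent fights with the owner of
group `j`. -/
structure Phase (𝒟 : Duel K (2 * l)) (B : ℕ) (σ : Fin m ≃ Fin N × Slot K) (j r : ℕ)
    (b : Bids (N + 1) m) : Prop where
  low : LowBids 𝒟 σ (progressAt l j r) b
  big : ∀ j', 1 ≤ b (Fin.last N) (σ.symm (j', .big))
  fresh : r = 0 → ∀ j' : Fin N, j ≤ j' → ∀ e, b (Fin.last N) (σ.symm (j', .tiny e)) = 0
  top : 0 < r → ∀ x, b (Fin.last N) x = (topWeight 𝒟 B j (2 * ((r - 1) / 2) + 1) (σ x) : ℕ)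

theorem one_le_topWeight_big (hB : 2 ≤ B) (j t : ℕ) (j' : Fin N) :
    1 ≤ topWeight 𝒟 B j t (j', .big) := by
  simp only [topWeight]
  split_ifs <;> omega

theorem Phase.top_step (hB : 2 ≤ B) {j : Fin N} {q : ℕ} (hq : q < l)
    (h : Phase 𝒟 B σ j (2 * q) b) :
    ¬ IsBestResponse R (duelInstance 𝒟 B σ) b (Fin.last N) ∧
      ∀ b', PotentialStep R (duelInstance 𝒟 B σ) (Fin.last N) b b' →
        Phase 𝒟 B σ j (2 * q + 1) b' := by
  have hv : progressAt l j (2 * q) j = 2 * q := by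
    simp only [progressAt, lt_irrefl, if_false, if_true]; omega
  have hbid : ∀ e, (1 ≤ 2 * q → 𝒟.bid (2 * q - 1) e = 0) →
      b (Fin.last N) (σ.symm (j, .tiny e)) = 0 := by
    intro e he
    rcases Nat.eq_zero_or_pos q with rfl | hpos
    · exact h.fresh rfl j le_rfl e
    · rw [h.top (by omega), show 2 * ((2 * q - 1) / 2) + 1 = 2 * q - 1 by omega]
      simp [topWeight, he (by omega)]
  obtain ⟨h1, h2⟩ := _root_.top_step (R := R) hB h.low hq hv
    (fun j' hj' => by simp [progressAt, hj'])
    (fun j' hj' => by simp [progressAt, hj'.not_gt, hj'.ne']) hbid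
  refine ⟨h1, fun b' hb' => ?_⟩
  rw [h2 b' hb']
  refine ⟨fun j' x => ?_, fun j' => ?_, by omega, fun _ x => ?_⟩
  · rw [Function.update_of_ne (Fin.castSucc_lt_last _).ne, h.low]
    simp only [progressAt, show (2 * q + 1) / 2 = 2 * q / 2 by omega]
  · rw [Function.update_self, Equiv.apply_symm_apply]
    exact_mod_cast one_le_topWeight_big hB _ _ _
  · rw [Function.update_self, show 2 * ((2 * q + 1 - 1) / 2) + 1 = 2 * q + 1 by omega]

theorem Phase.low_step {j : Fin N} {q : ℕ} (hq : q < l) (h : Phase 𝒟 B σ j (2 * q + 1) b) :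
    ¬ IsBestResponse R (duelInstance 𝒟 B σ) b j.castSucc ∧
      ∀ b', PotentialStep R (duelInstance 𝒟 B σ) j.castSucc b b' →
        Phase 𝒟 B σ j (2 * q + 2) b' := by
  have hv : progressAt l j (2 * q + 1) j = 2 * q := by
    simp only [progressAt, lt_irrefl, if_false, if_true]; omega
  have htop := h.top (Nat.succ_pos _)
  rw [show 2 * ((2 * q + 1 - 1) / 2) + 1 = 2 * q + 1 by omega] at htop
  obtain ⟨h1, h2⟩ := _root_.low_step (R := R) h.low hq hv htop
  refine ⟨h1, fun b' hb' => ?_⟩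
  rw [h2 b' hb']
  have hne : Fin.last N ≠ j.castSucc := (Fin.castSucc_lt_last _).ne'
  refine ⟨fun j' x => ?_, fun j' => ?_, by omega, fun _ x => ?_⟩
  · by_cases hj : j' = j
    · subst hj
      rw [Function.update_self]
      simp only [progressAt, lt_irrefl, if_false, if_true]
      rw [show 2 * ((2 * q + 2) / 2) = 2 * q + 2 by omega]
    · rw [Function.update_of_ne (fun h => hj (Fin.castSucc_injective _ h)), h.low]
      simp [progressAt, Fin.val_ne_of_ne hj]
  · rw [Function.update_of_ne hne]
    exact h.big j'
  · rw [Function.update_of_ne hne, htop,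
      show 2 * ((2 * q + 2 - 1) / 2) + 1 = 2 * q + 1 by omega]

/-- The fighting agent's bids still belong to group `j`, so they vanish on the contested items of
later groups. -/
theorem Phase.next {j : ℕ} (hl : 0 < l) (h : Phase 𝒟 B σ j (2 * l) b) :
    Phase 𝒟 B σ (j + 1) 0 b where
  low j' x := by
    rw [h.low]
    rcases lt_trichotomy (j' : ℕ) j with h1 | h1 | h1
    · simp [progressAt, h1, h1.trans (Nat.lt_succ_self j)]
    · simp [progressAt, h1]
    · simp [progressAt, h1.not_gt, h1.ne', Nat.not_lt.2 (Nat.succ_le_of_lt h1)]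
  big := h.big
  fresh _ j' hj' e := by
    rw [h.top (by omega)]
    simp [topWeight, show (j' : ℕ) ≠ j by omega]
  top h0 := absurd h0 (lt_irrefl 0)

/-- The agent activated at time `t`: the last agent in turn with the owner of the current group. -/
def duelist {N : ℕ} (hN : 0 < N) (l t : ℕ) : Fin (N + 1) :=
  if t % (2 * l) % 2 = 0 then Fin.last N
  else Fin.castSucc ⟨t / (2 * l) % N, Nat.mod_lt _ hN⟩

/-- The final time is step 0 of a phase `N` without an owner, hence the guard `j < N` for the next
step. -/
theorem phase_of_run (hB : 2 ≤ B) (hN : 0 < N) (hl : 0 < l) {b₀ : Bids (N + 1) m}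
    (h0 : Phase 𝒟 B σ 0 0 b₀) {b : ℕ → Bids (N + 1) m}
    (hrun : IsPotentialRun R (duelInstance 𝒟 B σ) b₀ (duelist hN l) b) :
    ∀ j r, r < 2 * l → j * (2 * l) + r ≤ N * (2 * l) →
      Phase 𝒟 B σ j r (b (j * (2 * l) + r)) ∧ (j < N →
        ¬ IsBestResponse R (duelInstance 𝒟 B σ) (b (j * (2 * l) + r))
          (duelist hN l (j * (2 * l) + r)) ∧
        Phase 𝒟 B σ j (r + 1) (b (j * (2 * l) + r + 1))) := by
  have hstep : ∀ j r, r < 2 * l → j < N → Phase 𝒟 B σ j r (b (j * (2 * l) + r)) →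
      ¬ IsBestResponse R (duelInstance 𝒟 B σ) (b (j * (2 * l) + r))
          (duelist hN l (j * (2 * l) + r)) ∧
        Phase 𝒟 B σ j (r + 1) (b (j * (2 * l) + r + 1)) := by
    intro j r hr hj h
    have hmod : (j * (2 * l) + r) % (2 * l) = r := by
      rw [Nat.mul_add_mod_of_lt hr]
    have hdiv : (j * (2 * l) + r) / (2 * l) = j := by
      rw [mul_comm, Nat.mul_add_div (by omega), Nat.div_eq_of_lt hr, add_zero]
    have hs := hrun.2 (j * (2 * l) + r)
    have hact : duelist hN l (j * (2 * l) + r) =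
        if r % 2 = 0 then Fin.last N else Fin.castSucc ⟨j, hj⟩ := by
      simp only [duelist, hmod, hdiv, Nat.mod_eq_of_lt hj]
    rw [hact] at hs ⊢
    rcases Nat.even_or_odd' r with ⟨q, rfl | rfl⟩
    · rw [if_pos (by omega)] at hs ⊢
      obtain ⟨h1, h2⟩ := Phase.top_step (j := ⟨j, hj⟩) (R := R) hB (by omega) h
      exact ⟨h1, h2 _ hs⟩
    · rw [if_neg (by omega)] at hs ⊢
      obtain ⟨h1, h2⟩ := Phase.low_step (j := ⟨j, hj⟩) (R := R) (by omega) h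
      exact ⟨h1, h2 _ hs⟩
  have hphase : ∀ j, j ≤ N → (∀ r, r < 2 * l → (j < N ∨ r = 0) →
      Phase 𝒟 B σ j r (b (j * (2 * l) + r))) := by
    intro j
    induction j with
    | zero =>
      intro _ r
      induction r with
      | zero => intro _ _; simpa [hrun.1] using h0
      | succ r ih =>
        intro hr hj
        exact (hstep 0 r (by omega) hN (ih (by omega) (Or.inl hN))).2
    | succ j ihj =>
      intro hjN r
      induction r with
      | zero =>
        intro _ _
        have h1 := (hstep j (2 * l - 1) (by omega) (by omega)
          (ihj (by omega) (2 * l - 1) (by omega) (Or.inl (by omega)))).2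
        rw [add_assoc, show 2 * l - 1 + 1 = 2 * l by omega] at h1
        rw [Nat.succ_mul, add_zero]
        exact h1.next hl
      | succ r ih =>
        intro hr hj
        have hj' : j + 1 < N := by omega
        exact (hstep (j + 1) r (by omega) hj' (ih (by omega) (Or.inl hj'))).2
  intro j r hr hT
  have hj : j < N ∨ (j = N ∧ r = 0) := by
    rcases lt_trichotomy j N with h | h | h
    · exact Or.inl h
    · subst h; right; omega
    · have := Nat.mul_le_mul_right (2 * l) (Nat.succ_le_of_lt h)
      rw [Nat.succ_mul] at this
      omega
  have h1 := hphase j (by omega) r hr (by tauto)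
  exact ⟨h1, fun hjN => hstep j r hr hjN h1⟩

theorem run_spec (hB : 2 ≤ B) (hN : 0 < N) (hl : 0 < l) {b₀ : Bids (N + 1) m}
    (h0 : Phase 𝒟 B σ 0 0 b₀) {b : ℕ → Bids (N + 1) m}
    (hrun : IsPotentialRun R (duelInstance 𝒟 B σ) b₀ (duelist hN l) b) :
    (∀ t < N * (2 * l), ¬ IsBestResponse R (duelInstance 𝒟 B σ) (b t) (duelist hN l t)) ∧
      ∀ t ≤ N * (2 * l), ∃ j r, Phase 𝒟 B σ j r (b t) := by
  have key := phase_of_run hB hN hl h0 hrun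
  have hdec : ∀ t, t / (2 * l) * (2 * l) + t % (2 * l) = t := fun t => Nat.div_add_mod' _ _
  have hmod : ∀ t, t % (2 * l) < 2 * l := fun t => Nat.mod_lt _ (by omega)
  constructor
  · intro t ht
    have h1 := key (t / (2 * l)) (t % (2 * l)) (hmod t) (by rw [hdec]; exact ht.le)
    rw [hdec] at h1
    exact (h1.2 (Nat.div_lt_of_lt_mul (by rwa [mul_comm]))).1
  · intro t ht
    have h1 := key (t / (2 * l)) (t % (2 * l)) (hmod t) (by rwa [hdec])
    rw [hdec] at h1
    exact ⟨_, _, h1.1⟩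

theorem le_activations {n : ℕ} {act : ℕ → Fin n} {T l : ℕ} {i : Fin n} (g : ℕ → ℕ)
    (hg : Function.Injective g) (hT : ∀ q < l, g q < T) (hact : ∀ q < l, act (g q) = i) :
    l ≤ activations act T i := by
  rw [activations, ← Finset.card_range l, ← Finset.card_image_of_injective _ hg]
  refine Finset.card_le_card fun t ht => ?_
  obtain ⟨q, hq, rfl⟩ := Finset.mem_image.1 ht
  rw [Finset.mem_range] at hq
  exact Finset.mem_filter.2 ⟨Finset.mem_range.2 (hT q hq), hact q hq⟩

theorem le_activations_duelist (hN : 0 < N) (i : Fin (N + 1)) :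
    l ≤ activations (duelist hN l) (N * (2 * l)) i := by
  have hle : ∀ j : Fin N, (j : ℕ) * (2 * l) + 2 * l ≤ N * (2 * l) := by
    intro j
    rw [← Nat.succ_mul]
    exact Nat.mul_le_mul_right _ j.2
  have hmod : ∀ j r, r < 2 * l → (j * (2 * l) + r) % (2 * l) = r := by
    intro j r hr
    rw [Nat.mul_add_mod_of_lt hr]
  induction i using Fin.lastCases with
  | last =>
    -- For the fighting agent, phase 0 alone gives enough activations.
    refine le_activations (fun q => 0 * (2 * l) + 2 * q) (fun a b h => by simpa using h)
      (fun q hq => ?_) fun q hq => ?_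
    · have := hle ⟨0, hN⟩
      simp only [zero_mul] at this ⊢
      omega
    · simp only [duelist]
      rw [hmod _ _ (by omega), if_pos (by omega)]
  | cast j =>
    refine le_activations (fun q => j * (2 * l) + (2 * q + 1)) (fun a b h => by simpa using h)
      (fun q hq => ?_) fun q hq => ?_
    · have := hle j
      omega
    · simp only [duelist]
      rw [hmod _ _ (by omega), if_neg (by omega)]
      congr 1
      ext
      simp only
      rw [mul_comm (j : ℕ), Nat.mul_add_div (by omega), Nat.div_eq_of_lt (by omega), add_zero,
        Nat.mod_eq_of_lt j.2]

end Run

/-! ### Welfare along the run against the optimum. -/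

section Welfare

variable {N K l m : ℕ} {𝒟 : Duel K (2 * l)} {B : ℕ} {σ : Fin m ≃ Fin N × Slot K}
  {R : AllocationRule (N + 1) m} {b : Bids (N + 1) m}

theorem sum_lowWeight_le (j : Fin N) {t : ℕ} (ht : t ≤ 2 * l) :
    ∑ y : Fin N × Slot K, lowWeight 𝒟 j t y ≤ 𝒟.bound + 3 * 𝒟.lure N := by
  have h := 𝒟.le_bound ht
  rw [sum_group_eq j _ fun y hy => lowWeight_ne 𝒟 (Fin.val_ne_of_ne hy), Slot.sum_eq]
  simp only [lowWeight, if_true]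
  split_ifs <;> omega

theorem sum_topWeight_le (j : Fin N) {t : ℕ} (ht : t ≤ 2 * l) :
    ∑ y : Fin N × Slot K, topWeight 𝒟 B j t y ≤
      B + (N * 𝒟.gap + 𝒟.lure N + 𝒟.bound + N) := by
  have h := 𝒟.le_bound ht
  have h1 : (N - (j : ℕ)) * 𝒟.gap ≤ N * 𝒟.gap := Nat.mul_le_mul_right _ (Nat.sub_le _ _)
  have h2 : ∑ y : Fin N × Slot K, topWeight 𝒟 B j t y = ∑ j' : Fin N, (if (j' : ℕ) = j then
      B + (N - (j : ℕ)) * 𝒟.gap + 𝒟.reserve t + (𝒟.lure N + ∑ e, 𝒟.bid t e) else 1) := by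
    rw [Fintype.sum_prod_type]
    refine Finset.sum_congr rfl fun j' _ => ?_
    rw [Slot.sum_eq]
    by_cases h : (j' : ℕ) = j
    · simp [topWeight, h]
    · simp [topWeight, h]
  have h3 := sum_ite_add_one j
    (B + (N - (j : ℕ)) * 𝒟.gap + 𝒟.reserve t + (𝒟.lure N + ∑ e, 𝒟.bid t e))
  omega

theorem sum_flatWeight : ∑ y : Fin N × Slot K, flatWeight y = N := by
  rw [Fintype.sum_prod_type]
  simp [Slot.sum_eq, flatWeight]

theorem sum_clauseWeight_last_le (c : Option (Option (Fin N × Fin l))) :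
    ∑ y, clauseWeight 𝒟 B (Fin.last N) c y ≤ B + (N * 𝒟.gap + 𝒟.lure N + 𝒟.bound + N) := by
  have hflat := sum_flatWeight (N := N) (K := K)
  rcases c with _ | _ | ⟨j, q⟩
  · simp only [clauseWeight, Fin.lastCases_last, hflat]; omega
  · simp only [clauseWeight, Fin.lastCases_last, hflat]; omega
  · rw [clauseWeight_last_some]
    exact sum_topWeight_le j (by omega)

theorem sum_clause_le_sum (i : Fin (N + 1)) (c : Option (Option (Fin N × Fin l)))
    (S : Finset (Fin m)) :
    ∑ x ∈ S, (duelInstance 𝒟 B σ).weight i (clauseEquiv N l c) x ≤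
      ((∑ y, clauseWeight 𝒟 B i c y : ℕ) : ℝ≥0) := by
  rw [← Equiv.sum_comp σ, Nat.cast_sum, Finset.sum_congr rfl fun x _ =>
    duelInstance_weight 𝒟 B σ i c x]
  exact Finset.sum_le_sum_of_subset (Finset.subset_univ S)

theorem value_le_of_forall {i : Fin (N + 1)} {S : Finset (Fin m)} {C : ℝ≥0}
    (h : ∀ c, ∑ x ∈ S, (duelInstance 𝒟 B σ).weight i (clauseEquiv N l c) x ≤ C) :
    (duelInstance 𝒟 B σ).value i S ≤ C := by
  refine Finset.sup_le fun ℓ _ => ?_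
  obtain ⟨c, rfl⟩ := (clauseEquiv N l).surjective ℓ
  exact h c

theorem value_last_le (S : Finset (Fin m)) :
    (duelInstance 𝒟 B σ).value (Fin.last N) S ≤
      ((B + (N * 𝒟.gap + 𝒟.lure N + 𝒟.bound + N) : ℕ) : ℝ≥0) :=
  value_le_of_forall fun c => (sum_clause_le_sum _ c S).trans
    (Nat.cast_le.2 (sum_clauseWeight_last_le c))

/-- Only `ownWeight` involves `B`, and it is worthless without the big item. -/
theorem value_castSucc_le {j : Fin N} {S : Finset (Fin m)} (hS : σ.symm (j, .big) ∉ S) :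
    (duelInstance 𝒟 B σ).value j.castSucc S ≤ ((𝒟.bound + 3 * 𝒟.lure N : ℕ) : ℝ≥0) := by
  refine value_le_of_forall fun c => ?_
  rcases c with _ | _ | ⟨j', q⟩
  · refine le_trans (le_of_eq (Finset.sum_eq_zero fun x hx => ?_)) (zero_le)
    rw [duelInstance_weight, Nat.cast_eq_zero]
    have hc : clauseWeight 𝒟 B j.castSucc none (σ x) = ownWeight B j (σ x) := by
      simp [clauseWeight]
    rw [hc]
    obtain ⟨y, rfl⟩ := σ.symm.surjective x
    rw [Equiv.apply_symm_apply]
    rcases y with ⟨j', _ | _ | _ | e⟩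
    · refine if_neg fun h => hS ?_
      have h' : j' = j := Fin.ext h
      rwa [h'] at hx
    all_goals rfl
  · refine (sum_clause_le_sum _ _ S).trans (Nat.cast_le.2 ?_)
    have hc : clauseWeight 𝒟 B j.castSucc (some none) = lowWeight 𝒟 j 0 := by simp [clauseWeight]
    rw [hc]
    exact sum_lowWeight_le j (Nat.zero_le _)
  · refine (sum_clause_le_sum _ _ S).trans (Nat.cast_le.2 ?_)
    rw [clauseWeight_castSucc_some]
    exact sum_lowWeight_le j (by omega)

theorem Phase.big_notMem_won {j r : ℕ} (h : Phase 𝒟 B σ j r b) (j' : Fin N) :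
    σ.symm (j', .big) ∉ R.won b j'.castSucc := by
  intro hmem
  rw [R.mem_won] at hmem
  have h1 := R.highest b (σ.symm (j', .big)) (Fin.last N)
  rw [hmem, h.low] at h1
  have h2 := (h.big j').trans h1
  simp [lowWeight] at h2

/-- All that the welfare can exceed the value `B` of a single big item. -/
def Duel.excess (𝒟 : Duel K (2 * l)) (N : ℕ) : ℕ :=
  N * (𝒟.bound + 3 * 𝒟.lure N) + (N * 𝒟.gap + 𝒟.lure N + 𝒟.bound + N)

theorem Phase.socialWelfare_le {j r : ℕ} (h : Phase 𝒟 B σ j r b) :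
    socialWelfare R (duelInstance 𝒟 B σ) b ≤ ((B + 𝒟.excess N : ℕ) : ℝ≥0) := by
  rw [socialWelfare, Fin.sum_univ_castSucc]
  refine (add_le_add (Finset.sum_le_sum fun j' _ => value_castSucc_le (h.big_notMem_won j'))
    (value_last_le _)).trans (le_of_eq ?_)
  rw [Finset.sum_const, Finset.card_univ, Fintype.card_fin, nsmul_eq_mul, Duel.excess]
  push_cast
  ring

/-- Give each owner its whole group. -/
theorem mul_le_opt : ((N * B : ℕ) : ℝ≥0) ≤ (duelInstance 𝒟 B σ).opt := by
  refine le_trans ?_ (Finset.le_sup (f := fun o : Fin m → Fin (N + 1) =>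
    ∑ i, (duelInstance 𝒟 B σ).value i (Finset.univ.filter fun x => o x = i))
    (Finset.mem_univ fun x => (σ x).1.castSucc))
  rw [Fin.sum_univ_castSucc]
  refine le_trans ?_ le_self_add
  have hB : ∀ j : Fin N, (B : ℝ≥0) ≤ (duelInstance 𝒟 B σ).value j.castSucc
      (Finset.univ.filter fun x => (σ x).1.castSucc = j.castSucc) := by
    intro j
    refine le_trans ?_ (XOSInstance.sum_weight_le_value _ _ (clauseEquiv N l none) _)
    have hmem : σ.symm (j, .big) ∈
        Finset.univ.filter fun x => (σ x).1.castSucc = j.castSucc := by simp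
    refine le_trans (le_of_eq ?_) (Finset.single_le_sum (fun _ _ => zero_le) hmem)
    rw [duelInstance_weight]
    simp [clauseWeight, ownWeight]
  refine le_trans (le_of_eq ?_) (Finset.sum_le_sum fun j _ => hB j)
  simp

/-- The initial bids: each agent bids its clause number zero. -/
noncomputable def initialBids (𝒟 : Duel K (2 * l)) (B : ℕ) (σ : Fin m ≃ Fin N × Slot K) :
    Bids (N + 1) m :=
  fun i => (duelInstance 𝒟 B σ).weight i (clauseEquiv N l (some none))

theorem phase_initialBids : Phase 𝒟 B σ 0 0 (initialBids 𝒟 B σ) where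
  low j x := by
    have h : progressAt l 0 0 j = 0 := by simp [progressAt]
    rw [initialBids, duelInstance_weight, h]
    simp [clauseWeight]
  big j := by
    rw [initialBids, duelInstance_weight]
    simp [clauseWeight, flatWeight]
  fresh _ j _ e := by
    rw [initialBids, duelInstance_weight]
    simp [clauseWeight, flatWeight]
  top h := absurd h (lt_irrefl 0)

theorem exists_bad_instance (hN : 0 < N) (hl : 0 < l) (𝒟 : Duel K (2 * l))
    (σ : Fin m ≃ Fin N × Slot K) (R : AllocationRule (N + 1) m) {ε : ℝ} (hε : 0 < ε) :
    ∃ (I : XOSInstance (N + 1) m) (b₀ : Bids (N + 1) m) (act : ℕ → Fin (N + 1)) (T : ℕ),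
      StrongNoOverbidding I b₀ ∧ (∀ i, l ≤ activations act T i) ∧
      ∀ b : ℕ → Bids (N + 1) m, IsPotentialRun R I b₀ act b →
        (∀ t < T, ¬ IsBestResponse R I (b t) (act t)) ∧
        (∀ t ≤ T, (socialWelfare R I (b t) : ℝ) ≤ (1 + ε) / (N : ℝ) * (I.opt : ℝ)) := by
  -- The excess does not depend on `B`, so a large `B` absorbs it. `2 ≤ B` makes the duel clauses
  -- beat `flatWeight`.
  obtain ⟨B, hB⟩ := exists_nat_ge (max 2 ((𝒟.excess N : ℝ) / ε))
  have hB2 : 2 ≤ B := by exact_mod_cast (le_max_left _ _).trans hB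
  have hBε : (𝒟.excess N : ℝ) ≤ ε * B := by
    rw [mul_comm]
    exact (div_le_iff₀ hε).1 ((le_max_right _ _).trans hB)
  refine ⟨duelInstance 𝒟 B σ, initialBids 𝒟 B σ, duelist hN l, N * (2 * l),
    fun i S => XOSInstance.sum_weight_le_value _ _ _ _, le_activations_duelist hN,
    fun b hrun => ?_⟩
  obtain ⟨h1, h2⟩ := run_spec hB2 hN hl phase_initialBids hrun
  refine ⟨h1, fun t ht => ?_⟩
  obtain ⟨j, r, h⟩ := h2 t ht
  have hN' : (0 : ℝ) < N := Nat.cast_pos.2 hN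
  calc (socialWelfare R (duelInstance 𝒟 B σ) (b t) : ℝ)
      ≤ ((B + 𝒟.excess N : ℕ) : ℝ) := by exact_mod_cast h.socialWelfare_le (R := R)
    _ ≤ (1 + ε) * B := by push_cast; linarith
    _ = (1 + ε) / (N : ℝ) * ((N * B : ℕ) : ℝ) := by push_cast; field_simp
    _ ≤ (1 + ε) / (N : ℝ) * ((duelInstance 𝒟 B σ).opt : ℝ) := by
      refine mul_le_mul_of_nonneg_left ?_ (by positivity)
      exact_mod_cast mul_le_opt (𝒟 := 𝒟) (B := B) (σ := σ)

end Welfare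

/-! ### Choice of parameters and growth rate. -/

theorem walkLength_eq_two_mul (κ : ℕ) : walkLength κ = 2 * (2 ^ (κ + 1) - 1) := by
  have : 1 ≤ 2 ^ κ := Nat.one_le_two_pow
  rw [walkLength, pow_succ]
  omega

theorem isBigO_two_pow_sub :
    Asymptotics.IsBigO Filter.atTop (fun k : ℕ => (2 : ℝ) ^ k)
      (fun k : ℕ => ((2 ^ (k - 6) - 1 : ℕ) : ℝ)) := by
  -- With `k = κ + 7`, `2 ^ k = 128 * 2 ^ κ` and `2 ^ κ ≤ 2 ^ (κ + 1) - 1`.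
  refine Asymptotics.IsBigO.of_bound 128 (Filter.eventually_atTop.2 ⟨7, fun k hk => ?_⟩)
  obtain ⟨κ, rfl⟩ : ∃ κ, k = κ + 7 := ⟨k - 7, by omega⟩
  have h : 1 ≤ 2 ^ κ := Nat.one_le_two_pow
  have h' : (1 : ℝ) ≤ 2 ^ κ := by exact_mod_cast h
  rw [show κ + 7 - 6 = κ + 1 by omega, Real.norm_of_nonneg (by positivity),
    Real.norm_of_nonneg (Nat.cast_nonneg _), Nat.cast_sub Nat.one_le_two_pow]
  push_cast
  rw [pow_succ 2 κ, pow_add 2 κ 7]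
  linarith

theorem theorem5p3 :
    ∃ f : ℕ → ℕ,
      Asymptotics.IsBigO Filter.atTop (fun k : ℕ => (2 : ℝ) ^ k) (fun k : ℕ => (f k : ℝ)) ∧
      ∀ (ε : ℝ), 0 < ε → ∀ (n : ℕ), 2 ≤ n → ∀ (k : ℕ)
        (R : AllocationRule n ((n - 1) * (k + 1))),
        ∃ (I : XOSInstance n ((n - 1) * (k + 1))) (b₀ : Bids n ((n - 1) * (k + 1)))
          (act : ℕ → Fin n) (T : ℕ),
          StrongNoOverbidding I b₀ ∧
          (∀ i : Fin n, f k ≤ activations act T i) ∧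
          ∀ b : ℕ → Bids n ((n - 1) * (k + 1)), IsPotentialRun R I b₀ act b →
            (∀ t < T, ¬ IsBestResponse R I (b t) (act t)) ∧
            (∀ t ≤ T, (socialWelfare R I (b t) : ℝ) ≤ (1 + ε) / ((n : ℝ) - 1) * (I.opt : ℝ)) := by
  -- A group has `κ + 5` contested and 3 further items, so `k = κ + 7`; `f k` is half of `walkLength
  -- κ`.
  refine ⟨fun k => 2 ^ (k - 6) - 1, isBigO_two_pow_sub, fun ε hε n hn k R => ?_⟩
  obtain ⟨N, rfl⟩ : ∃ N, n = N + 1 := ⟨n - 1, by omega⟩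
  have hN : 0 < N := by omega
  have hcast : ((N + 1 : ℕ) : ℝ) - 1 = N := by push_cast; ring
  rw [hcast]
  rcases lt_or_ge k 7 with hk | hk
  -- For small `k`, `f k = 0`: zero valuations and no steps suffice.
  · refine ⟨⟨fun _ => 0, fun _ _ _ => 0⟩, fun _ _ => 0, fun _ => 0, 0, fun i S => by simp,
      fun i => ?_, fun b _ => ⟨fun t ht => absurd ht (Nat.not_lt_zero t), fun t _ => ?_⟩⟩
    · simp [show k - 6 = 0 by omega]
    · rw [show socialWelfare R _ (b t) = 0 by simp [socialWelfare, XOSInstance.value]]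
      exact mul_nonneg (by positivity) (NNReal.coe_nonneg _)
  · obtain ⟨κ, rfl⟩ : ∃ κ, k = κ + 7 := ⟨k - 7, by omega⟩
    have hcard : Fintype.card (Fin N × Slot (κ + 5)) = (N + 1 - 1) * (κ + 7 + 1) := by
      rw [Fintype.card_prod, Fintype.card_fin, Slot.card, Nat.add_sub_cancel]
    have hl : 0 < 2 ^ (κ + 1) - 1 := by
      have : 1 ≤ 2 ^ κ := Nat.one_le_two_pow
      rw [pow_succ]
      omega
    have h := exists_bad_instance hN hl (walkLength_eq_two_mul κ ▸ longDuel κ)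
      (Fintype.equivFinOfCardEq hcard).symm R hε
    simpa only [show κ + 7 - 6 = κ + 1 by omega] using h
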